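/- Let $\mathbb H$ be a real Hilbert space and $Q\ge 1$. For $V=(x,y,r,s)\in\mathbb H\times\mathbb H\times(0,\infty)\times(0,\infty)$ put \[ \mathcal D_Q=\{V:\ 1\le rs\le Q\},\qquad \mathcal D_Q^{\varepsilon}=\{V\in\mathcal D_Q:\ \varepsilon\le r\le\varepsilon^{-1},\ \varepsilon\le s\le\varepsilon^{-1}\}\quad(0<\varepsilon<1), \] \[ K(r,s)=\frac{\sqrt{rs}}{\sqrt Q}\Bigl(1-\frac{\sqrt{rs}}{8\sqrt Q}\Bigr),\qquad N(r,s)=\frac{\sqrt{rs}}{\sqrt Q}\Bigl(1-\frac{(rs)^2}{128Q^2}\Bigr), \] \[ B_1=\frac{|x|^2}{r}+\frac{|y|^2}{s},\quad B_2=\frac{|x|^2}{2r-\frac1{s(N+1)}}+\frac{|y|^2}{s},\quad B_3=\frac{|x|^2}{r}+\frac{|y|^2}{2s-\frac1{r(N+1)}}, \] \[ B_4=\sup_{a>0}\Bigl(\frac{|x|^2}{r+aK}+\frac{|y|^2}{s+a^{-1}K}\Bigr),\quad B_5=\frac{|x|^2}{2r-\frac1{s(K+1)}}+\frac{|y|^2}{s},\quad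 B_6=\frac{|x|^2}{r}+\frac{|y|^2}{2s-\frac1{r(K+1)}}, \] and $B_7=B_4+B_5+B_6$. There are absolute constants $c_1,c_2,c_3,c_7,C>0$ (independent of $\mathbb H$, $Q$, $\varepsilon$ and $V$) such that the function \[ B=B_Q=c_1B_1+c_2B_2+c_3B_3+c_7B_7 \] has the following properties. (i) The formula for $B$ defines a $\mathcal C^1$ function in a neighbourhood of each point of $\mathcal D_Q$ (hence $B$ is $\mathcal C^1$ on every $\mathcal D_Q^\varepsilon$). (ii) $B$ is piecewise $\mathcal C^2$ on $\mathcal D_Q$: there are finitely many pairwise disjoint relatively open subsets of $\mathcal D_Q$ whose closures cover $\mathcal D_Q$, such that $B$ is $\mathcal C^2$ near every point of each of them. Moreover $B$ is $\mathcal C^2$ near every point of $\mathcal D_Q$ with $|y|r\ne|x|K(r,s)$ and $|x|s\ne|y|K(r,s)$. (iii) For $V\in\mathcal D_Q$, \[ 0\le B(V)\le C\Bigl(\frac{|x|^2}{r}+\frac{|y|^2}{s}\Bigr). \] (iv) At every $V\in\mathcal D_Q$ near which $B$ is $\mathcal C^2$, for every $\mathrm dV=(\mathrm dx,\mathrm dy,\mathrm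 dr,\mathrm ds)\in\mathbb H\times\mathbb H\times\mathbb R\times\mathbb R$, \[ (\mathrm d^2B(V)\,\mathrm dV,\mathrm dV)\ge\frac2Q|\mathrm dx||\mathrm dy|. \] (v) For all $V=(x,y,r,s)$ and $V_0=(x_0,y_0,r_0,s_0)$ in $\mathcal D_Q$, \[ B(V)-B(V_0)-\mathrm dB(V_0)(V-V_0)\ge\frac2Q|x-x_0||y-y_0|. \] (vi) For all $0<\varepsilon<1$ and $V=(x,y,r,s)\in\mathcal D_Q^\varepsilon$: if $B(\cdot,y,r,s)$ is $\mathcal C^2$ near $x$, then \[ |(\partial_x^2B(V)\,\mathrm dx,\mathrm dx)|\le C\varepsilon^{-1}|\mathrm dx|^2\qquad(\mathrm dx\in\mathbb H), \] and if $B(x,\cdot,r,s)$ is $\mathcal C^2$ near $y$, then \[ |(\partial_y^2B(V)\,\mathrm dy,\mathrm dy)|\le C\varepsilon^{-1}|\mathrm dy|^2\qquad(\mathrm dy\in\mathbb H). \] -/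

import Mathlib

noncomputable section

namespace Bellman

/-- `K(r,s) = √(rs)/√Q · (1 - √(rs)/(8√Q))`. -/
def K (Q r s : ℝ) : ℝ :=
  √(r * s) / √Q * (1 - √(r * s) / (8 * √Q))

/-- `N(r,s) = √(rs)/√Q · (1 - (rs)²/(128Q²))`. -/
def N (Q r s : ℝ) : ℝ :=
  √(r * s) / √Q * (1 - (r * s) ^ 2 / (128 * Q ^ 2))

section Functions

variable {H : Type*} [NormedAddCommGroup H]

/-- The domain `1 ≤ rs ≤ Q`, `r, s > 0`, in the variables `V = (x, y, r, s)`. -/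
def domain (H : Type*) (Q : ℝ) : Set (H × H × ℝ × ℝ) :=
  {V | 0 < V.2.2.1 ∧ 0 < V.2.2.2 ∧
    1 ≤ V.2.2.1 * V.2.2.2 ∧ V.2.2.1 * V.2.2.2 ≤ Q}

/-- The truncated domain: moreover `ε ≤ r ≤ ε⁻¹` and `ε ≤ s ≤ ε⁻¹`. -/
def truncDomain (H : Type*) (Q ε : ℝ) : Set (H × H × ℝ × ℝ) :=
  {V | V ∈ domain H Q ∧ ε ≤ V.2.2.1 ∧ V.2.2.1 ≤ ε⁻¹ ∧ ε ≤ V.2.2.2 ∧ V.2.2.2 ≤ ε⁻¹}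

def B₁ : H × H × ℝ × ℝ → ℝ := fun (x, y, r, s) =>
  ‖x‖ ^ 2 / r + ‖y‖ ^ 2 / s

def B₂ (Q : ℝ) : H × H × ℝ × ℝ → ℝ := fun (x, y, r, s) =>
  ‖x‖ ^ 2 / (2 * r - 1 / (s * (N Q r s + 1))) + ‖y‖ ^ 2 / s

def B₃ (Q : ℝ) : H × H × ℝ × ℝ → ℝ := fun (x, y, r, s) =>
  ‖x‖ ^ 2 / r + ‖y‖ ^ 2 / (2 * s - 1 / (r * (N Q r s + 1)))

/-- `H₄(x,y,r,s,k) = sup_{a > 0} ( |x|²/(r + ak) + |y|²/(s + a⁻¹k) )`. The family is bounded above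
(by `|x|²/r + |y|²/s`) whenever `r, s > 0` and `k ≥ 0`. -/
def H₄ (x y : H) (r s k : ℝ) : ℝ :=
  ⨆ a : Set.Ioi (0 : ℝ), (‖x‖ ^ 2 / (r + a * k) + ‖y‖ ^ 2 / (s + (a : ℝ)⁻¹ * k))

def B₄ (Q : ℝ) : H × H × ℝ × ℝ → ℝ := fun (x, y, r, s) =>
  H₄ x y r s (K Q r s)

def B₅ (Q : ℝ) : H × H × ℝ × ℝ → ℝ := fun (x, y, r, s) =>
  ‖x‖ ^ 2 / (2 * r - 1 / (s * (K Q r s + 1))) + ‖y‖ ^ 2 / s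

def B₆ (Q : ℝ) : H × H × ℝ × ℝ → ℝ := fun (x, y, r, s) =>
  ‖x‖ ^ 2 / r + ‖y‖ ^ 2 / (2 * s - 1 / (r * (K Q r s + 1)))

def B₇ (Q : ℝ) : H × H × ℝ × ℝ → ℝ := fun V =>
  B₄ Q V + B₅ Q V + B₆ Q V

/-- The Bellman function `B = c₁B₁ + c₂B₂ + c₃B₃ + c₇B₇`. -/
def B (c₁ c₂ c₃ c₇ Q : ℝ) : H × H × ℝ × ℝ → ℝ := fun V =>
  c₁ * B₁ V + c₂ * B₂ Q V + c₃ * B₃ Q V + c₇ * B₇ Q V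

end Functions

/-- `f` is piecewise `C²` on `D`: there are finitely many pairwise disjoint relatively open pieces
of `D` whose closures cover `D`, and `f` is `C²` at every point of each piece. -/
def IsPiecewiseC2On {E : Type*} [NormedAddCommGroup E] [NormedSpace ℝ E]
    (f : E → ℝ) (D : Set E) : Prop :=
  ∃ (n : ℕ) (U : Fin n → Set E),
    (∀ i, IsOpen (U i)) ∧
    (∀ i j, i ≠ j → Disjoint (U i ∩ D) (U j ∩ D)) ∧
    D ⊆ ⋃ i, closure (U i ∩ D) ∧
    ∀ i, ∀ V ∈ U i ∩ D, ContDiffAt ℝ 2 f V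

end Bellman

end

noncomputable section

namespace Bellman

open Filter Topology

/-! Both convexity statements rest on one explicit two-point inequality, `B_defect`, valid for every
pair of points with 1/2 < rs < 2Q. No segment between the points is followed, since the region rs ≤
Q is not convex; the Hessian bound is deduced from the two-point one, not conversely. The weight
region is enlarged to an open set so that differentiation makes sense at boundary points of the
domain.

Each constituent composes a convex function, decreasing in its denominators, with concave functions
of (r, s). Its two-point defect therefore dominates perfect squares plus multiples of concavity
defects. To use this, write x - x₀ = (x - r x₀/r₀) + (r - r₀) x₀/r₀, and likewise for y. The product
|x - x₀||y - y₀| splits into four terms. Those containing a remainder x - r x₀/r₀ or y - s y₀/s₀ are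
absorbed by Young's inequality into the squares produced by B₁ and into the terms s(r - r₀)²/Q² and
r(s - s₀)²/Q² produced by B₂ and B₃ (`M_N_defect`). The last term, with |r - r₀||s - s₀|/Q, is paid
by B₇ (`B₇_defect`), because that quantity is controlled by the concavity defect of K (`K_defect`).

B₄ is convex because `H₄` is a supremum of expressions affine in (x, y, r, s, k), in which k has
coefficient -2|a||b| (`dual_le_H₄`, `H₄_eq_dual`). The maximisers a, b have lengths comparable with
|x₀|/r₀ and |y₀|/s₀ except where one of x₀, y₀ is small relative to the other; there B₅ or B₆ takes
over.

The maximisers vary continuously, so the affine supports of B₄ form a continuous family and B₄ is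
C¹. They are also Lipschitz in x and in y, which bounds the second partial derivatives. -/

/-- The variable `√(rs) / √Q` through which `K` and `N` depend on `(r, s)`. -/
def T (Q r s : ℝ) : ℝ := √(r * s) / √Q

/-- A pair of weights in the open region `1/2 < rs < 2Q`, which contains `1 ≤ rs ≤ Q`. -/
structure Admissible (Q r s : ℝ) : Prop where
  one_le : 1 ≤ Q
  r_pos : 0 < r
  s_pos : 0 < s
  half_lt : 1 / 2 < r * s
  lt_two_mul : r * s < 2 * Q

lemma T_comm (Q r s : ℝ) : T Q s r = T Q r s := by rw [T, T, mul_comm]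

lemma K_comm (Q r s : ℝ) : K Q s r = K Q r s := by rw [K, K, mul_comm s r]

lemma N_comm (Q r s : ℝ) : N Q s r = N Q r s := by rw [N, N, mul_comm s r]

lemma Admissible.symm {Q r s : ℝ} (h : Admissible Q r s) : Admissible Q s r :=
  ⟨h.one_le, h.s_pos, h.r_pos, by rw [mul_comm]; exact h.half_lt,
    by rw [mul_comm]; exact h.lt_two_mul⟩

lemma K_eq (Q r s : ℝ) : K Q r s = T Q r s - T Q r s ^ 2 / 8 := by
  rw [K, T, ← div_div, div_right_comm]; ring

/-! ### Concavity of `T`, `K` and `N` in the weights. -/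

section Scalars

variable {Q r s r₀ s₀ : ℝ}

lemma Admissible.Q_pos (h : Admissible Q r s) : 0 < Q := by linarith [h.one_le]

lemma Admissible.T_pos (h : Admissible Q r s) : 0 < T Q r s :=
  div_pos (Real.sqrt_pos.2 (mul_pos h.r_pos h.s_pos)) (Real.sqrt_pos.2 h.Q_pos)

lemma Admissible.T_sq (h : Admissible Q r s) : T Q r s ^ 2 = r * s / Q := by
  rw [T, div_pow, Real.sq_sqrt (mul_pos h.r_pos h.s_pos).le, Real.sq_sqrt h.Q_pos.le]

lemma Admissible.N_eq (h : Admissible Q r s) : N Q r s = T Q r s - T Q r s ^ 5 / 128 := by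
  have h4 : T Q r s ^ 4 = (r * s) ^ 2 / Q ^ 2 := by
    rw [← div_pow, ← h.T_sq]; ring
  have : N Q r s = T Q r s * (1 - (r * s) ^ 2 / Q ^ 2 / 128) := by
    rw [N, T, div_div, mul_comm (Q ^ 2) 128]
  rw [this, ← h4]; ring

lemma Admissible.T_sq_lt (h : Admissible Q r s) : T Q r s ^ 2 < 2 := by
  rw [h.T_sq, div_lt_iff₀ h.Q_pos]; exact h.lt_two_mul

lemma Admissible.T_lt (h : Admissible Q r s) : T Q r s < 3 / 2 := by
  nlinarith [h.T_sq_lt, h.T_pos]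

lemma Admissible.K_pos (h : Admissible Q r s) : 0 < K Q r s := by
  rw [K_eq]; nlinarith [h.T_lt, h.T_pos]

lemma Admissible.K_le (h : Admissible Q r s) : K Q r s ≤ 2 := by
  rw [K_eq]; nlinarith [h.T_lt, h.T_pos]

/-- K < T and T² = rs/Q ≤ rs. This keeps the discriminant rs - k² positive in the closed form of
`H₄`. -/
lemma Admissible.K_sq_lt (h : Admissible Q r s) : K Q r s ^ 2 < r * s := by
  have h1 : K Q r s < T Q r s := by rw [K_eq]; nlinarith [h.T_pos]
  have h2 : K Q r s ^ 2 < T Q r s ^ 2 := by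
    nlinarith [h.K_pos, h.T_pos]
  refine h2.trans_le ?_
  rw [h.T_sq]
  exact div_le_self (mul_pos h.r_pos h.s_pos).le h.one_le

lemma Admissible.N_pos (h : Admissible Q r s) : 0 < N Q r s := by
  have h1 : N Q r s = T Q r s * (1 - (T Q r s ^ 2) ^ 2 / 128) := by rw [h.N_eq]; ring
  rw [h1]
  have := h.T_sq_lt
  have h2 : (T Q r s ^ 2) ^ 2 < 4 := by nlinarith [sq_nonneg (T Q r s)]
  exact mul_pos h.T_pos (by linarith)

lemma Admissible.N_le (h : Admissible Q r s) : N Q r s ≤ 2 := by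
  rw [h.N_eq]
  have := pow_pos h.T_pos 5
  linarith [h.T_lt]

/-- The differential of `T` at `(r₀, s₀)` applied to `(dr, ds)`. -/
def dT (Q r₀ s₀ dr ds : ℝ) : ℝ := T Q r₀ s₀ / 2 * (dr / r₀ + ds / s₀)

/-- The differential of `K` at `(r₀, s₀)` applied to `(dr, ds)`. -/
def dK (Q r₀ s₀ dr ds : ℝ) : ℝ := (1 - T Q r₀ s₀ / 4) * dT Q r₀ s₀ dr ds

/-- The differential of `N` at `(r₀, s₀)` applied to `(dr, ds)`. -/
def dN (Q r₀ s₀ dr ds : ℝ) : ℝ := (1 - 5 * T Q r₀ s₀ ^ 4 / 128) * dT Q r₀ s₀ dr ds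

lemma dT_comm (Q r₀ s₀ dr ds : ℝ) : dT Q s₀ r₀ ds dr = dT Q r₀ s₀ dr ds := by
  rw [dT, dT, T_comm]; ring

lemma dK_comm (Q r₀ s₀ dr ds : ℝ) : dK Q s₀ r₀ ds dr = dK Q r₀ s₀ dr ds := by
  rw [dK, dK, T_comm, dT_comm]

lemma dN_comm (Q r₀ s₀ dr ds : ℝ) : dN Q s₀ r₀ ds dr = dN Q r₀ s₀ dr ds := by
  rw [dN, dN, T_comm, dT_comm]

lemma dK_smul (Q r₀ s₀ c dr ds : ℝ) : dK Q r₀ s₀ (c * dr) (c * ds) = c * dK Q r₀ s₀ dr ds := by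
  rw [dK, dK, dT, dT]; ring

lemma dN_smul (Q r₀ s₀ c dr ds : ℝ) : dN Q r₀ s₀ (c * dr) (c * ds) = c * dN Q r₀ s₀ dr ds := by
  rw [dN, dN, dT, dT]; ring

/-- The concavity defect of `T`, and the identity relating it to `(r - r₀)(s - s₀)`. -/
lemma T_defect (h₀ : Admissible Q r₀ s₀) (h : Admissible Q r s) :
    0 ≤ T Q r₀ s₀ + dT Q r₀ s₀ (r - r₀) (s - s₀) - T Q r s ∧
    (r - r₀) * (s - s₀) / Q = (T Q r s - T Q r₀ s₀) ^ 2
      - 2 * T Q r₀ s₀ * (T Q r₀ s₀ + dT Q r₀ s₀ (r - r₀) (s - s₀) - T Q r s) := by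
  have hr := h₀.r_pos
  have hs := h₀.s_pos
  have hQ := h₀.Q_pos
  have e0 := h₀.T_sq
  have e := h.T_sq
  have p0 := h₀.T_pos
  have p := h.T_pos
  have hd : dT Q r₀ s₀ (r - r₀) (s - s₀) = T Q r₀ s₀ / 2 * (r / r₀ + s / s₀) - T Q r₀ s₀ := by
    rw [dT]; field_simp; ring
  have hrel : T Q r s ^ 2 = T Q r₀ s₀ ^ 2 * (r / r₀ * (s / s₀)) := by
    rw [e, e0]; field_simp
  have hρ : 0 < r / r₀ := div_pos h.r_pos hr
  have hσ : 0 < s / s₀ := div_pos h.s_pos hs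
  have hprod : (r - r₀) * (s - s₀) / Q = T Q r₀ s₀ ^ 2 * ((r / r₀ - 1) * (s / s₀ - 1)) := by
    rw [e0]; field_simp
  rw [hd, hprod]
  generalize r / r₀ = ρ at *
  generalize s / s₀ = σ at *
  generalize T Q r₀ s₀ = a at *
  generalize T Q r s = b at *
  refine ⟨?_, by linear_combination -hrel⟩
  -- AM-GM, since b² = a²ρσ.
  have : b ≤ a / 2 * (ρ + σ) := by
    apply le_of_sq_le_sq _ (by positivity)
    rw [hrel]; nlinarith [mul_nonneg (sq_nonneg a) (sq_nonneg (ρ - σ))]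
  linarith

/-- One-leg concavity of `K`, with a quantitative defect. -/
lemma K_defect (h₀ : Admissible Q r₀ s₀) (h : Admissible Q r s) :
    |r - r₀| * |s - s₀| / Q ≤
      8 * (K Q r₀ s₀ + dK Q r₀ s₀ (r - r₀) (s - s₀) - K Q r s) := by
  obtain ⟨hg, he⟩ := T_defect h₀ h
  have habs : |r - r₀| * |s - s₀| / Q = |(r - r₀) * (s - s₀) / Q| := by
    rw [abs_div, abs_mul, abs_of_pos h₀.Q_pos]
  have p0 := h₀.T_pos
  have l0 := h₀.T_lt
  rw [habs, he, K_eq, K_eq, dK]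
  generalize T Q r₀ s₀ = a at *
  generalize T Q r s = b at *
  generalize dT Q r₀ s₀ (r - r₀) (s - s₀) = d at *
  -- With g the defect of T, eight times the defect of K is (8 - 2a)g + (b - a)², while the product
  -- to be bounded is (b - a)² - 2ag. The square comes from the correction T²/8, and a < 3/2 gives 8
  -- - 2a ≥ 2a.
  rw [abs_le]
  constructor <;> nlinarith [mul_nonneg p0.le hg, sq_nonneg (b - a)]

lemma K_defect_nonneg (h₀ : Admissible Q r₀ s₀) (h : Admissible Q r s) :
    0 ≤ K Q r₀ s₀ + dK Q r₀ s₀ (r - r₀) (s - s₀) - K Q r s := by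
  have := K_defect h₀ h
  have h2 : 0 ≤ |r - r₀| * |s - s₀| / Q :=
    div_nonneg (mul_nonneg (abs_nonneg _) (abs_nonneg _)) h.Q_pos.le
  linarith

lemma Admissible.T_pow_four_lt (h : Admissible Q r s) : T Q r s ^ 4 < 4 := by
  have := h.T_sq_lt
  nlinarith [sq_nonneg (T Q r s)]

lemma N_defect_nonneg (h₀ : Admissible Q r₀ s₀) (h : Admissible Q r s) :
    0 ≤ N Q r₀ s₀ + dN Q r₀ s₀ (r - r₀) (s - s₀) - N Q r s := by
  obtain ⟨hg, -⟩ := T_defect h₀ h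
  have p0 := h₀.T_pos
  have p := h.T_pos
  have l0 := h₀.T_pow_four_lt
  rw [h₀.N_eq, h.N_eq, dN]
  generalize T Q r₀ s₀ = a at *
  generalize T Q r s = b at *
  generalize dT Q r₀ s₀ (r - r₀) (s - s₀) = d at *
  -- The second summand is the convexity remainder of the fifth power.
  have e : a - a ^ 5 / 128 + (1 - 5 * a ^ 4 / 128) * d - (b - b ^ 5 / 128)
      = (1 - 5 * a ^ 4 / 128) * (a + d - b)
        + (b - a) ^ 2 * (b ^ 3 + 2 * b ^ 2 * a + 3 * b * a ^ 2 + 4 * a ^ 3) / 128 := by ring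
  rw [e]
  have h1 : 0 ≤ 1 - 5 * a ^ 4 / 128 := by linarith
  positivity

/-- N is a function of T whose difference quotients are at least 1/2: the quintic correction
contributes at most 64/128. -/
lemma sq_T_sub_le (h₀ : Admissible Q r₀ s₀) (h : Admissible Q r s) :
    (T Q r s - T Q r₀ s₀) ^ 2 ≤ 4 * (N Q r s - N Q r₀ s₀) ^ 2 := by
  have p0 := h₀.T_pos
  have p := h.T_pos
  have l0 := h₀.T_lt
  have l := h.T_lt
  rw [h₀.N_eq, h.N_eq]
  generalize T Q r₀ s₀ = a at *
  generalize T Q r s = b at *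
  have hb : ∀ {x y : ℝ}, 0 < x → 0 < y → x < 3 / 2 → y < 3 / 2 → x * y ≤ 9 / 4 := by
    intro x y hx hy hx' hy'; nlinarith
  have h1 : b ^ 2 ≤ 9 / 4 := by nlinarith
  have h2 : a ^ 2 ≤ 9 / 4 := by nlinarith
  have h3 := hb p p0 l l0
  have h4 : 0 < b * a := mul_pos p p0
  have hS : b ^ 4 + b ^ 3 * a + b ^ 2 * a ^ 2 + b * a ^ 3 + a ^ 4 ≤ 64 := by
    nlinarith [sq_nonneg a, sq_nonneg b]
  have hS0 : 0 ≤ b ^ 4 + b ^ 3 * a + b ^ 2 * a ^ 2 + b * a ^ 3 + a ^ 4 := by positivity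
  have e : b - b ^ 5 / 128 - (a - a ^ 5 / 128) =
      (b - a) * (1 - (b ^ 4 + b ^ 3 * a + b ^ 2 * a ^ 2 + b * a ^ 3 + a ^ 4) / 128) := by ring
  rw [e, mul_pow]
  generalize b ^ 4 + b ^ 3 * a + b ^ 2 * a ^ 2 + b * a ^ 3 + a ^ 4 = S at *
  have : 1 / 4 ≤ (1 - S / 128) ^ 2 := by nlinarith
  nlinarith [sq_nonneg (b - a)]

/-! ### Concavity of the denominators. -/

/-- The denominator `2r - 1 / (sz)`. -/
def M (r s z : ℝ) : ℝ := 2 * r - 1 / (s * z)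

/-- The differential of `M` at `(r₀, s₀, z₀)`. -/
def dM (s₀ z₀ dr ds dz : ℝ) : ℝ := 2 * dr + ds / (s₀ ^ 2 * z₀) + dz / (s₀ * z₀ ^ 2)

/-- Since 1/(sz) is convex, `M` is concave, and it increases with z. The exact defect is the defect
of z, weighted, plus a quadratic form a² + ab + b² z₀/z in the relative increments of s and z. As
z₀/z ≥ 1/3, this form is coercive. -/
lemma M_defect {z z₀ dz : ℝ} (hs₀ : 0 < s₀) (hs : 0 < s) (hz₀ : 1 ≤ z₀) (hz : 1 ≤ z)
    (hz' : z ≤ 3) :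
    (z₀ + dz - z) / (s₀ * z₀ ^ 2) + ((s - s₀) ^ 2 / s₀ ^ 2 + (z - z₀) ^ 2 / z₀ ^ 2) / (16 * s * z₀) ≤
      M r₀ s₀ z₀ + dM s₀ z₀ (r - r₀) (s - s₀) dz - M r s z := by
  have hz0 : 0 < z₀ := by linarith
  have hzp : 0 < z := by linarith
  have e : M r₀ s₀ z₀ + dM s₀ z₀ (r - r₀) (s - s₀) dz - M r s z =
      (z₀ + dz - z) / (s₀ * z₀ ^ 2) +
      ((s - s₀) ^ 2 / s₀ ^ 2 + (s - s₀) / s₀ * ((z - z₀) / z₀) + (z - z₀) ^ 2 / z₀ ^ 2 * (z₀ / z))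
        / (s * z₀) := by
    rw [M, M, dM]; field_simp; ring
  rw [e]
  have e2 : ((s - s₀) ^ 2 / s₀ ^ 2 + (z - z₀) ^ 2 / z₀ ^ 2) / (16 * s * z₀) =
      (((s - s₀) / s₀) ^ 2 + ((z - z₀) / z₀) ^ 2) / 16 / (s * z₀) := by
    field_simp
  rw [e2, ← div_pow, ← div_pow]
  gcongr
  have h3 : 1 / 3 ≤ z₀ / z := by
    rw [div_le_div_iff₀ (by norm_num) hzp]; linarith
  generalize (s - s₀) / s₀ = a
  generalize (z - z₀) / z₀ = b
  nlinarith [mul_le_mul_of_nonneg_left h3 (sq_nonneg b), sq_nonneg (15 * a + 8 * b)]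

/-- This is what the lower bound rs > 1/2 serves: 1/(sz) ≤ 1/s < 2r. -/
lemma M_pos {z : ℝ} (h : Admissible Q r s) (hz : 1 ≤ z) : 0 < M r s z := by
  have hs := h.s_pos
  have hsz : 0 < s * z := mul_pos hs (by linarith)
  have : 1 / (s * z) < 2 * r := by
    rw [div_lt_iff₀ hsz]
    nlinarith [h.half_lt, mul_nonneg (mul_pos h.r_pos hs).le (sub_nonneg.2 hz)]
  rw [M]; linarith

lemma M_le {z : ℝ} (h : Admissible Q r s) (hz : 1 ≤ z) : M r s z ≤ 2 * r := by
  have : 0 < 1 / (s * z) := one_div_pos.2 (mul_pos h.s_pos (by linarith))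
  rw [M]; linarith

lemma le_M {z : ℝ} (hs : 0 < s) (h : 1 ≤ r * s) (hz : 1 ≤ z) : r ≤ M r s z := by
  have : 1 / (s * z) ≤ r := by
    rw [div_le_iff₀ (mul_pos hs (by linarith))]
    nlinarith
  rw [M]; linarith

/-- The denominator built on `K` inherits the full concavity defect of `K`. -/
lemma M_K_defect (h₀ : Admissible Q r₀ s₀) (h : Admissible Q r s) :
    (K Q r₀ s₀ + dK Q r₀ s₀ (r - r₀) (s - s₀) - K Q r s) / (9 * s₀) ≤
      M r₀ s₀ (K Q r₀ s₀ + 1) + dM s₀ (K Q r₀ s₀ + 1) (r - r₀) (s - s₀)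
        (dK Q r₀ s₀ (r - r₀) (s - s₀)) - M r s (K Q r s + 1) := by
  have hz₀ : 1 ≤ K Q r₀ s₀ + 1 := by linarith [h₀.K_pos]
  have hz : 1 ≤ K Q r s + 1 := by linarith [h.K_pos]
  have hs := h.s_pos
  have hs₀ := h₀.s_pos
  have h1 := M_defect (r := r) (r₀ := r₀) (dz := dK Q r₀ s₀ (r - r₀) (s - s₀)) hs₀ hs hz₀ hz
    (by linarith [h.K_le])
  refine le_trans ?_ h1
  -- The quadratic part is discarded; only the defect of K is kept, and (K + 1)² ≤ 9 gives the
  -- constant.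
  have h2 : 0 ≤ ((s - s₀) ^ 2 / s₀ ^ 2 + (K Q r s + 1 - (K Q r₀ s₀ + 1)) ^ 2 / (K Q r₀ s₀ + 1) ^ 2)
      / (16 * s * (K Q r₀ s₀ + 1)) := by positivity
  have h3 := K_defect_nonneg h₀ h
  have h4 : (K Q r₀ s₀ + dK Q r₀ s₀ (r - r₀) (s - s₀) - K Q r s) / (9 * s₀) ≤
      (K Q r₀ s₀ + 1 + dK Q r₀ s₀ (r - r₀) (s - s₀) - (K Q r s + 1)) / (s₀ * (K Q r₀ s₀ + 1) ^ 2) := by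
    have e : K Q r₀ s₀ + 1 + dK Q r₀ s₀ (r - r₀) (s - s₀) - (K Q r s + 1) =
      K Q r₀ s₀ + dK Q r₀ s₀ (r - r₀) (s - s₀) - K Q r s := by ring
    rw [e]
    have : (K Q r₀ s₀ + 1) ^ 2 ≤ 9 := by nlinarith [h₀.K_le, h₀.K_pos]
    apply div_le_div_of_nonneg_left h3 (by positivity)
    nlinarith
  linarith

/-- The denominator built on `N` has a concavity defect controlling `s (r - r₀)² / Q²`. -/
lemma M_N_defect (h₀ : Admissible Q r₀ s₀) (h : Admissible Q r s) :
    s * (r - r₀) ^ 2 / Q ^ 2 ≤ 31104 *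
      (M r₀ s₀ (N Q r₀ s₀ + 1) + dM s₀ (N Q r₀ s₀ + 1) (r - r₀) (s - s₀)
        (dN Q r₀ s₀ (r - r₀) (s - s₀)) - M r s (N Q r s + 1)) := by
  have hz₀ : 1 ≤ N Q r₀ s₀ + 1 := by linarith [h₀.N_pos]
  have hz : 1 ≤ N Q r s + 1 := by linarith [h.N_pos]
  have hs := h.s_pos
  have hs₀ := h₀.s_pos
  have hQ := h.Q_pos
  have hr₀ := h₀.r_pos
  have h1 := M_defect (r := r) (r₀ := r₀) (dz := dN Q r₀ s₀ (r - r₀) (s - s₀)) hs₀ hs hz₀ hz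
    (by linarith [h.N_le])
  have h3 : 0 ≤ (N Q r₀ s₀ + 1 + dN Q r₀ s₀ (r - r₀) (s - s₀) - (N Q r s + 1)) /
      (s₀ * (N Q r₀ s₀ + 1) ^ 2) := by
    apply div_nonneg _ (by positivity)
    linarith [N_defect_nonneg h₀ h]
  -- The increment of r is recovered from those of T² and s, hence from those of N and s, which the
  -- quadratic part of `M_defect` controls.
  have hd : T Q r s ^ 2 - T Q r₀ s₀ ^ 2 * (s / s₀) = s * (r - r₀) / Q := by
    rw [h.T_sq, h₀.T_sq]; field_simp
  have h5 : s * (r - r₀) ^ 2 / Q ^ 2 =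
      ((T Q r s ^ 2 - T Q r₀ s₀ ^ 2) - T Q r₀ s₀ ^ 2 * ((s - s₀) / s₀)) ^ 2 / s := by
    have : (T Q r s ^ 2 - T Q r₀ s₀ ^ 2) - T Q r₀ s₀ ^ 2 * ((s - s₀) / s₀) =
      s * (r - r₀) / Q := by rw [← hd]; field_simp; ring
    rw [this]; field_simp
  have hT := sq_T_sub_le h₀ h
  have hsum : (T Q r s + T Q r₀ s₀) ^ 2 ≤ 9 := by
    nlinarith [h.T_pos, h₀.T_pos, h.T_lt, h₀.T_lt]
  have h6 : (T Q r s ^ 2 - T Q r₀ s₀ ^ 2) ^ 2 ≤ 36 * (N Q r s - N Q r₀ s₀) ^ 2 := by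
    have : (T Q r s ^ 2 - T Q r₀ s₀ ^ 2) ^ 2 =
      (T Q r s + T Q r₀ s₀) ^ 2 * (T Q r s - T Q r₀ s₀) ^ 2 := by ring
    rw [this]
    nlinarith [sq_nonneg (T Q r s - T Q r₀ s₀)]
  have h7 : (N Q r s - N Q r₀ s₀) ^ 2 ≤ 9 * ((N Q r s - N Q r₀ s₀) ^ 2 / (N Q r₀ s₀ + 1) ^ 2) := by
    rw [← mul_div_assoc, le_div_iff₀ (by positivity)]
    have : (N Q r₀ s₀ + 1) ^ 2 ≤ 9 := by nlinarith [h₀.N_le, h₀.N_pos]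
    nlinarith [sq_nonneg (N Q r s - N Q r₀ s₀)]
  have h8 := h₀.T_pow_four_lt
  -- 648 = 2 · 36 · 9, the factor 2 coming from (u - v)² ≤ 2u² + 2v².
  have h9 : s * (r - r₀) ^ 2 / Q ^ 2 ≤
      648 * ((s - s₀) ^ 2 / s₀ ^ 2 + (N Q r s - N Q r₀ s₀) ^ 2 / (N Q r₀ s₀ + 1) ^ 2) / s := by
    rw [h5]
    apply div_le_div_of_nonneg_right _ hs.le
    rw [← div_pow (s - s₀)]
    generalize (s - s₀) / s₀ = p
    have : (T Q r₀ s₀ ^ 2 * p) ^ 2 ≤ 4 * p ^ 2 := by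
      have : (T Q r₀ s₀ ^ 2 * p) ^ 2 = T Q r₀ s₀ ^ 4 * p ^ 2 := by ring
      nlinarith [sq_nonneg p]
    nlinarith [sq_nonneg (T Q r s ^ 2 - T Q r₀ s₀ ^ 2 + T Q r₀ s₀ ^ 2 * p), sq_nonneg p]
  -- 31104 = 648 · 16 · 3, using N + 1 ≤ 3.
  have h10 : 648 * ((s - s₀) ^ 2 / s₀ ^ 2 + (N Q r s - N Q r₀ s₀) ^ 2 / (N Q r₀ s₀ + 1) ^ 2) / s ≤
      31104 * (((s - s₀) ^ 2 / s₀ ^ 2 +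
        (N Q r s + 1 - (N Q r₀ s₀ + 1)) ^ 2 / (N Q r₀ s₀ + 1) ^ 2) / (16 * s * (N Q r₀ s₀ + 1))) := by
    have e : N Q r s + 1 - (N Q r₀ s₀ + 1) = N Q r s - N Q r₀ s₀ := by ring
    rw [e]
    have hnn : 0 ≤ (s - s₀) ^ 2 / s₀ ^ 2 + (N Q r s - N Q r₀ s₀) ^ 2 / (N Q r₀ s₀ + 1) ^ 2 := by
      positivity
    generalize (s - s₀) ^ 2 / s₀ ^ 2 + (N Q r s - N Q r₀ s₀) ^ 2 / (N Q r₀ s₀ + 1) ^ 2 = p at *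
    rw [← mul_div_assoc, div_le_div_iff₀ hs (by positivity)]
    have : p * s * (N Q r₀ s₀ + 1) ≤ p * s * 3 := by
      gcongr; linarith [h₀.N_le]
    linarith
  linarith

end Scalars

/-! ### The supremum `H₄`: closed forms, dual representation, optimal vectors. -/

section Concave

variable {H : Type*} [NormedAddCommGroup H]

lemma bddAbove_H₄ (x y : H) {r s k : ℝ} (hr : 0 < r) (hs : 0 < s) (hk : 0 ≤ k) :
    BddAbove (Set.range fun a : Set.Ioi (0 : ℝ) =>
      ‖x‖ ^ 2 / (r + a * k) + ‖y‖ ^ 2 / (s + (a : ℝ)⁻¹ * k)) := by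
  refine ⟨‖x‖ ^ 2 / r + ‖y‖ ^ 2 / s, ?_⟩
  rintro _ ⟨⟨a, ha⟩, rfl⟩
  have ha' : 0 < a := ha
  have h1 : 0 ≤ a * k := by positivity
  have h2 : 0 ≤ a⁻¹ * k := by positivity
  dsimp only
  gcongr <;> linarith

lemma term_le_H₄ (x y : H) {r s k a : ℝ} (hr : 0 < r) (hs : 0 < s) (hk : 0 ≤ k) (ha : 0 < a) :
    ‖x‖ ^ 2 / (r + a * k) + ‖y‖ ^ 2 / (s + a⁻¹ * k) ≤ H₄ x y r s k :=
  le_ciSup (bddAbove_H₄ x y hr hs hk) (⟨a, ha⟩ : Set.Ioi (0 : ℝ))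

lemma H₄_le (x y : H) {r s k c : ℝ}
    (h : ∀ a : ℝ, 0 < a → ‖x‖ ^ 2 / (r + a * k) + ‖y‖ ^ 2 / (s + a⁻¹ * k) ≤ c) :
    H₄ x y r s k ≤ c :=
  haveI : Nonempty (Set.Ioi (0 : ℝ)) := ⟨⟨1, Set.mem_Ioi.2 one_pos⟩⟩
  ciSup_le fun a => h a a.2

lemma H₄_le_add (x y : H) {r s k : ℝ} (hr : 0 < r) (hs : 0 < s) (hk : 0 ≤ k) :
    H₄ x y r s k ≤ ‖x‖ ^ 2 / r + ‖y‖ ^ 2 / s := by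
  refine H₄_le x y fun a ha => ?_
  have h1 : 0 ≤ a * k := by positivity
  have h2 : 0 ≤ a⁻¹ * k := by positivity
  gcongr <;> linarith

lemma H₄_nonneg (x y : H) {r s k : ℝ} (hr : 0 < r) (hs : 0 < s) (hk : 0 ≤ k) :
    0 ≤ H₄ x y r s k :=
  le_trans (by positivity) (term_le_H₄ x y hr hs hk one_pos)

lemma H₄_comm (x y : H) {r s k : ℝ} (hr : 0 < r) (hs : 0 < s) (hk : 0 ≤ k) :
    H₄ y x s r k = H₄ x y r s k := by
  apply le_antisymm
  · refine H₄_le y x fun a ha => ?_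
    have := term_le_H₄ x y hr hs hk (inv_pos.2 ha)
    rw [inv_inv] at this; linarith
  · refine H₄_le x y fun a ha => ?_
    have := term_le_H₄ y x hs hr hk (inv_pos.2 ha)
    rw [inv_inv] at this; linarith

lemma div_le_H₄ (x y : H) {r s k : ℝ} (hr : 0 < r) (hs : 0 < s) (hk : 0 ≤ k) :
    ‖x‖ ^ 2 / r ≤ H₄ x y r s k := by
  have hlim : Filter.Tendsto (fun a : ℝ => ‖x‖ ^ 2 / (r + a * k)) (nhdsWithin 0 (Set.Ioi 0))
      (nhds (‖x‖ ^ 2 / r)) := by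
    have hc : ContinuousAt (fun a : ℝ => ‖x‖ ^ 2 / (r + a * k)) 0 :=
      ContinuousAt.div (by fun_prop) (by fun_prop) (by simp [hr.ne'])
    have := hc.tendsto
    simp only [zero_mul, add_zero] at this
    exact this.mono_left nhdsWithin_le_nhds
  refine le_of_tendsto hlim ?_
  filter_upwards [self_mem_nhdsWithin] with a ha
  have ha' : 0 < a := ha
  refine le_trans ?_ (term_le_H₄ x y hr hs hk ha)
  have : 0 ≤ ‖y‖ ^ 2 / (s + a⁻¹ * k) := by positivity
  linarith

lemma div_le_H₄' (x y : H) {r s k : ℝ} (hr : 0 < r) (hs : 0 < s) (hk : 0 ≤ k) :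
    ‖y‖ ^ 2 / s ≤ H₄ x y r s k := by
  rw [← H₄_comm x y hr hs hk]; exact div_le_H₄ y x hs hr hk

lemma H₄_eq_left (x y : H) {r s k : ℝ} (hr : 0 < r) (hs : 0 < s) (hk : 0 ≤ k)
    (hrs : k ^ 2 < r * s) (h : ‖y‖ * r ≤ ‖x‖ * k) : H₄ x y r s k = ‖x‖ ^ 2 / r := by
  refine le_antisymm (H₄_le x y fun a ha => ?_) (div_le_H₄ x y hr hs hk)
  -- It suffices to treat the largest admissible ‖y‖; the remaining difference then has the sign of
  -- rs - k².
  have hy : ‖y‖ ≤ ‖x‖ * k / r := by rw [le_div_iff₀ hr]; exact h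
  have e : ‖y‖ ^ 2 / (s + a⁻¹ * k) ≤ (‖x‖ * k / r) ^ 2 / (s + a⁻¹ * k) := by gcongr
  refine le_trans (add_le_add_right e _) ?_
  have hm : 0 < r + a * k := by positivity
  have hn : 0 < s * a + k := by positivity
  have e2 : ‖x‖ ^ 2 / r - (‖x‖ ^ 2 / (r + a * k) + (‖x‖ * k / r) ^ 2 / (s + a⁻¹ * k)) =
      ‖x‖ ^ 2 * a ^ 2 * k * (r * s - k ^ 2) / (r ^ 2 * (r + a * k) * (s * a + k)) := by
    have : s + a⁻¹ * k = (s * a + k) / a := by field_simp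
    rw [this]; field_simp; ring
  have : 0 ≤ ‖x‖ ^ 2 * a ^ 2 * k * (r * s - k ^ 2) / (r ^ 2 * (r + a * k) * (s * a + k)) := by
    have := sub_pos.2 hrs
    positivity
  linarith

lemma H₄_eq_right (x y : H) {r s k : ℝ} (hr : 0 < r) (hs : 0 < s) (hk : 0 ≤ k)
    (hrs : k ^ 2 < r * s) (h : ‖x‖ * s ≤ ‖y‖ * k) : H₄ x y r s k = ‖y‖ ^ 2 / s := by
  rw [← H₄_comm x y hr hs hk]
  exact H₄_eq_left y x hs hr hk (by rwa [mul_comm s r]) h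

/-- The right side exceeds each competitor by a nonnegative multiple of a square, which vanishes at
the critical a. -/
lemma H₄_le_center (x y : H) {r s k : ℝ} (hr : 0 < r) (hs : 0 < s) (hk : 0 ≤ k)
    (hrs : k ^ 2 < r * s) :
    H₄ x y r s k ≤ (s * ‖x‖ ^ 2 + r * ‖y‖ ^ 2 - 2 * k * ‖x‖ * ‖y‖) / (r * s - k ^ 2) := by
  refine H₄_le x y fun a ha => ?_
  have hm : 0 < r + a * k := by positivity
  have hn : 0 < s * a + k := by positivity
  have hd := sub_pos.2 hrs
  have e2 : (s * ‖x‖ ^ 2 + r * ‖y‖ ^ 2 - 2 * k * ‖x‖ * ‖y‖) / (r * s - k ^ 2) -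
      (‖x‖ ^ 2 / (r + a * k) + ‖y‖ ^ 2 / (s + a⁻¹ * k)) =
      k * ((s * a + k) * ‖x‖ - (r + a * k) * ‖y‖) ^ 2 /
        ((r * s - k ^ 2) * (r + a * k) * (s * a + k)) := by
    have : s + a⁻¹ * k = (s * a + k) / a := by field_simp
    obtain ⟨D, hD⟩ : ∃ D, D = r * s - k ^ 2 := ⟨_, rfl⟩
    rw [this, ← hD]
    rw [← hD] at hd
    field_simp
    rw [hD]; ring
  have : 0 ≤ k * ((s * a + k) * ‖x‖ - (r + a * k) * ‖y‖) ^ 2 /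
        ((r * s - k ^ 2) * (r + a * k) * (s * a + k)) := by positivity
  linarith

variable [InnerProductSpace ℝ H]

/-- Fenchel duality for the square: expand ‖x - m a‖² ≥ 0. -/
lemma quad_le_div (a x : H) {m : ℝ} (hm : 0 < m) :
    2 * inner ℝ a x - m * ‖a‖ ^ 2 ≤ ‖x‖ ^ 2 / m := by
  rw [le_div_iff₀ hm]
  have h := norm_sub_sq_real x (m • a)
  rw [norm_smul, Real.norm_of_nonneg hm.le, inner_smul_right, real_inner_comm] at h
  nlinarith [sq_nonneg ‖x - m • a‖]

/-- `H₄` dominates every affine-in-`(x, y, r, s, k)` expression of the dual problem. -/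
lemma dual_le_H₄ (a b x y : H) {r s k : ℝ} (hr : 0 < r) (hs : 0 < s) (hk : 0 ≤ k) :
    2 * inner ℝ a x + 2 * inner ℝ b y - r * ‖a‖ ^ 2 - s * ‖b‖ ^ 2 - 2 * k * (‖a‖ * ‖b‖) ≤
      H₄ x y r s k := by
  rcases eq_or_ne a 0 with rfl | ha
  · refine le_trans ?_ (div_le_H₄' x y hr hs hk)
    have := quad_le_div b y hs
    simp; linarith
  rcases eq_or_ne b 0 with rfl | hb
  · refine le_trans ?_ (div_le_H₄ x y hr hs hk)
    have := quad_le_div a x hr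
    simp; linarith
  have ha' := norm_pos_iff.2 ha
  have hb' := norm_pos_iff.2 hb
  -- This parameter splits 2k‖a‖‖b‖ evenly between the two quadratic terms.
  have hl : 0 < ‖b‖ / ‖a‖ := div_pos hb' ha'
  refine le_trans ?_ (term_le_H₄ x y hr hs hk hl)
  have h1 := quad_le_div a x (m := r + ‖b‖ / ‖a‖ * k) (by positivity)
  have h2 := quad_le_div b y (m := s + (‖b‖ / ‖a‖)⁻¹ * k) (by positivity)
  have e1 : (r + ‖b‖ / ‖a‖ * k) * ‖a‖ ^ 2 = r * ‖a‖ ^ 2 + k * (‖a‖ * ‖b‖) := by field_simp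
  have e2 : (s + (‖b‖ / ‖a‖)⁻¹ * k) * ‖b‖ ^ 2 = s * ‖b‖ ^ 2 + k * (‖a‖ * ‖b‖) := by field_simp
  linarith

/-- The length of the optimal dual vector: the positive part of the constrained maximiser. -/
def optLen (X Y r s k : ℝ) : ℝ := max 0 (min (X / r) ((s * X - k * Y) / (r * s - k ^ 2)))

/-- The optimal dual vector. -/
def optVec (x y : H) (r s k : ℝ) : H := (optLen ‖x‖ ‖y‖ r s k / ‖x‖) • x

lemma optLen_nonneg (X Y r s k : ℝ) : 0 ≤ optLen X Y r s k := le_max_left _ _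

lemma optLen_le {X Y r s k : ℝ} (hX : 0 ≤ X) (hr : 0 < r) : optLen X Y r s k ≤ X / r :=
  max_le (by positivity) (min_le_left _ _)

lemma optLen_zero {Y r s k : ℝ} (hr : 0 < r) : optLen 0 Y r s k = 0 :=
  le_antisymm ((optLen_le le_rfl hr).trans (by simp)) (optLen_nonneg _ _ _ _ _)

lemma norm_optVec (x y : H) {r s k : ℝ} (hr : 0 < r) :
    ‖optVec x y r s k‖ = optLen ‖x‖ ‖y‖ r s k := by
  rw [optVec, norm_smul, Real.norm_of_nonneg (div_nonneg (optLen_nonneg _ _ _ _ _) (norm_nonneg _))]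
  rcases eq_or_ne x 0 with rfl | hx
  · simp [optLen_zero hr]
  · exact div_mul_cancel₀ _ (norm_ne_zero_iff.2 hx)

lemma inner_optVec (x y : H) (r s k : ℝ) :
    inner ℝ (optVec x y r s k) x = optLen ‖x‖ ‖y‖ r s k * ‖x‖ := by
  rw [optVec, real_inner_smul_left, real_inner_self_eq_norm_sq]
  rcases eq_or_ne x 0 with rfl | hx
  · simp
  · have := norm_ne_zero_iff.2 hx
    field_simp

lemma optLen_of_left {X Y r s k : ℝ} (hX : 0 ≤ X) (hr : 0 < r) (hk : 0 ≤ k)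
    (hrs : k ^ 2 < r * s) (h : Y * r ≤ X * k) : optLen X Y r s k = X / r := by
  have hd := sub_pos.2 hrs
  have : X / r ≤ (s * X - k * Y) / (r * s - k ^ 2) := by
    rw [div_le_div_iff₀ hr hd]; nlinarith
  rw [optLen, min_eq_left this, max_eq_right (by positivity)]

lemma optLen_of_right {X Y r s k : ℝ} (hrs : k ^ 2 < r * s) (h : X * s ≤ Y * k) :
    optLen X Y r s k = 0 := by
  have hd := sub_pos.2 hrs
  refine max_eq_left (min_le_of_right_le ?_)
  exact div_nonpos_of_nonpos_of_nonneg (by linarith) hd.le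

lemma optLen_of_center {X Y r s k : ℝ} (hr : 0 < r) (hk : 0 ≤ k)
    (hrs : k ^ 2 < r * s) (h : X * k ≤ Y * r) (h' : Y * k ≤ X * s) :
    optLen X Y r s k = (s * X - k * Y) / (r * s - k ^ 2) := by
  have hd := sub_pos.2 hrs
  have : (s * X - k * Y) / (r * s - k ^ 2) ≤ X / r := by
    rw [div_le_div_iff₀ hd hr]; nlinarith
  rw [optLen, min_eq_right this, max_eq_right (div_nonneg (by linarith) hd.le)]

/-- The dual expression is attained at the optimal vectors. -/
lemma H₄_eq_dual (x y : H) {r s k : ℝ} (hr : 0 < r) (hs : 0 < s) (hk : 0 ≤ k)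
    (hrs : k ^ 2 < r * s) :
    H₄ x y r s k = 2 * inner ℝ (optVec x y r s k) x + 2 * inner ℝ (optVec y x s r k) y
      - r * ‖optVec x y r s k‖ ^ 2 - s * ‖optVec y x s r k‖ ^ 2
      - 2 * k * (‖optVec x y r s k‖ * ‖optVec y x s r k‖) := by
  refine le_antisymm ?_ (dual_le_H₄ _ _ x y hr hs hk)
  have hsr : k ^ 2 < s * r := by rwa [mul_comm s r]
  have hd := sub_pos.2 hrs
  rw [inner_optVec x y, inner_optVec y x, norm_optVec x y hr, norm_optVec y x hs]
  rcases le_total (‖y‖ * r) (‖x‖ * k) with h | h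
  · rw [H₄_eq_left x y hr hs hk hrs h, optLen_of_left (norm_nonneg _) hr hk hrs h,
      optLen_of_right hsr h]
    apply le_of_eq; field_simp; ring
  rcases le_total (‖x‖ * s) (‖y‖ * k) with h' | h'
  · rw [H₄_eq_right x y hr hs hk hrs h', optLen_of_left (norm_nonneg _) hs hk hsr h',
      optLen_of_right hrs h']
    apply le_of_eq; field_simp; ring
  · refine (H₄_le_center x y hr hs hk hrs).trans ?_
    rw [optLen_of_center hr hk hrs h h', optLen_of_center hs hk hsr h' h, mul_comm s r]
    obtain ⟨D, hD⟩ : ∃ D, D = r * s - k ^ 2 := ⟨_, rfl⟩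
    rw [← hD] at hd ⊢
    apply le_of_eq
    field_simp
    rw [hD]; ring

lemma H₄_eq_center (x y : H) {r s k : ℝ} (hr : 0 < r) (hs : 0 < s) (hk : 0 ≤ k)
    (hrs : k ^ 2 < r * s) (h : ‖x‖ * k ≤ ‖y‖ * r) (h' : ‖y‖ * k ≤ ‖x‖ * s) :
    H₄ x y r s k = (s * ‖x‖ ^ 2 + r * ‖y‖ ^ 2 - 2 * k * ‖x‖ * ‖y‖) / (r * s - k ^ 2) := by
  have hsr : k ^ 2 < s * r := by rwa [mul_comm s r]
  have hd := sub_pos.2 hrs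
  rw [H₄_eq_dual x y hr hs hk hrs, inner_optVec x y, inner_optVec y x, norm_optVec x y hr,
    norm_optVec y x hs, optLen_of_center hr hk hrs h h', optLen_of_center hs hk hsr h' h,
    mul_comm s r]
  obtain ⟨D, hD⟩ : ∃ D, D = r * s - k ^ 2 := ⟨_, rfl⟩
  rw [← hD] at hd ⊢
  field_simp
  rw [hD]; ring

/-- Away from the cut the optimal vector is comparable with the unconstrained one. -/
lemma half_le_optLen {X Y r s k : ℝ} (hX : 0 ≤ X) (hr : 0 < r) (hs : 0 < s)
    (hrs : k ^ 2 < r * s) (h : 2 * k * (Y / s) / r ≤ X / r) : X / r / 2 ≤ optLen X Y r s k := by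
  have hd := sub_pos.2 hrs
  refine le_max_of_le_right (le_min ?_ ?_)
  · have : 0 ≤ X / r := by positivity
    linarith
  -- Hence sX - kY ≥ sX/2, and dividing by rs - k² instead of rs only increases the quotient.
  · have h1 : 2 * k * Y ≤ X * s := by
      have h0 : 2 * k * (Y / s) ≤ X := (div_le_div_iff_of_pos_right hr).1 h
      have : 2 * k * (Y / s) = 2 * k * Y / s := by ring
      rw [this, div_le_iff₀ hs] at h0
      exact h0
    rw [div_div, div_le_div_iff₀ (by positivity) hd]
    nlinarith [mul_nonneg hX (sq_nonneg k)]

lemma optLen_lipschitz {X X' Y r s k : ℝ} (hr : 0 < r) (hs : 0 < s) (hrs : k ^ 2 < r * s) :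
    |optLen X Y r s k - optLen X' Y r s k| ≤ s / (r * s - k ^ 2) * |X - X'| := by
  have hd := sub_pos.2 hrs
  have h1 : |X / r - X' / r| ≤ s / (r * s - k ^ 2) * |X - X'| := by
    rw [← sub_div, abs_div, abs_of_pos hr, div_eq_mul_inv, mul_comm]
    gcongr
    rw [inv_eq_one_div, div_le_div_iff₀ hr hd]; nlinarith [sq_nonneg k]
  have h2 : |(s * X - k * Y) / (r * s - k ^ 2) - (s * X' - k * Y) / (r * s - k ^ 2)| ≤
      s / (r * s - k ^ 2) * |X - X'| := by
    have : (s * X - k * Y) / (r * s - k ^ 2) - (s * X' - k * Y) / (r * s - k ^ 2) =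
      s / (r * s - k ^ 2) * (X - X') := by ring
    rw [this, abs_mul, abs_of_pos (div_pos hs hd)]
  rw [optLen, optLen]
  refine (abs_max_sub_max_le_max _ _ _ _).trans (max_le (by simp; positivity) ?_)
  exact (abs_min_sub_min_le_max _ _ _ _).trans (max_le h1 h2)

/-- The optimal vector is Lipschitz in the first variable. -/
lemma optVec_lipschitz (x x' y : H) {r s k : ℝ} (hr : 0 < r) (hs : 0 < s)
    (hrs : k ^ 2 < r * s) :
    ‖optVec x y r s k - optVec x' y r s k‖ ≤ 3 * (s / (r * s - k ^ 2)) * ‖x - x'‖ := by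
  have hd := sub_pos.2 hrs
  have hl : 1 / r ≤ s / (r * s - k ^ 2) := by
    rw [div_le_div_iff₀ hr hd]; nlinarith [sq_nonneg k]
  have hb : ∀ z : H, ‖optVec z y r s k‖ ≤ s / (r * s - k ^ 2) * ‖z‖ := by
    intro z
    rw [norm_optVec z y hr]
    refine (optLen_le (norm_nonneg _) hr).trans ?_
    rw [div_eq_mul_one_div, mul_comm]
    gcongr
  have hl0 : 0 < s / (r * s - k ^ 2) := div_pos hs hd
  rcases eq_or_ne x 0 with rfl | hx
  · have := hb x'
    simp only [optVec, smul_zero, zero_sub, norm_neg] at this ⊢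
    nlinarith [norm_nonneg x']
  rcases eq_or_ne x' 0 with rfl | hx'
  · have := hb x
    simp only [optVec, smul_zero, sub_zero] at this ⊢
    nlinarith [norm_nonneg x]
  have hX := norm_pos_iff.2 hx
  have hX' := norm_pos_iff.2 hx'
  set f := optLen ‖x‖ ‖y‖ r s k with hf
  set f' := optLen ‖x'‖ ‖y‖ r s k with hf'
  -- The change of length is separated from the change of direction. Three differences arise, each
  -- bounded by ‖x - x'‖, whence the factor 3.
  have e : optVec x y r s k - optVec x' y r s k =
      ((f - f') / ‖x‖) • x + (f' / ‖x'‖) • (((‖x'‖ - ‖x‖) / ‖x‖) • x + (x - x')) := by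
    have e1 : f / ‖x‖ = (f - f') / ‖x‖ + f' / ‖x'‖ * ((‖x'‖ - ‖x‖) / ‖x‖) + f' / ‖x'‖ := by
      field_simp; ring
    rw [optVec, optVec, ← hf, ← hf', e1]
    module
  have hff : |f - f'| ≤ s / (r * s - k ^ 2) * ‖x - x'‖ :=
    (optLen_lipschitz hr hs hrs).trans
      (mul_le_mul_of_nonneg_left (abs_norm_sub_norm_le x x') hl0.le)
  have hf'0 : 0 ≤ f' := optLen_nonneg _ _ _ _ _
  have hq : f' / ‖x'‖ ≤ s / (r * s - k ^ 2) := by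
    rw [div_le_iff₀ hX']
    have := hb x'
    rwa [norm_optVec x' y hr] at this
  have hn : ∀ c : ℝ, ‖(c / ‖x‖) • x‖ = |c| := by
    intro c
    rw [norm_smul, Real.norm_eq_abs, abs_div, abs_norm, div_mul_cancel₀ _ hX.ne']
  rw [e]
  calc _ ≤ |f - f'| + f' / ‖x'‖ * (|‖x'‖ - ‖x‖| + ‖x - x'‖) := by
        refine (norm_add_le _ _).trans ?_
        rw [hn, norm_smul, Real.norm_of_nonneg (by positivity)]
        gcongr
        refine (norm_add_le _ _).trans ?_
        rw [hn]
    _ ≤ s / (r * s - k ^ 2) * ‖x - x'‖ + s / (r * s - k ^ 2) * (‖x - x'‖ + ‖x - x'‖) := by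
        gcongr
        rw [abs_sub_comm]; exact abs_norm_sub_norm_le x x'
    _ = _ := by ring

end Concave

/-! ### From supports and two-point bounds to derivatives. -/

section Calculus

variable {E : Type*} [NormedAddCommGroup E] [NormedSpace ℝ E]

/-- A homogeneous lower support of a differentiable function is its derivative. -/
lemma fderiv_eq_of_support {f : E → ℝ} {V₀ : E} (hf : DifferentiableAt ℝ f V₀) {l : E → ℝ}
    (hl : ∀ (c : ℝ) v, l (c • v) = c * l v) (h : ∀ᶠ V in 𝓝 V₀, f V₀ + l (V - V₀) ≤ f V) (v : E) :
    fderiv ℝ f V₀ v = l v := by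
  have hline : HasDerivAt (fun t : ℝ => V₀ + t • v) v 0 := by
    simpa using ((hasDerivAt_id (0 : ℝ)).smul_const v).const_add V₀
  have hg : HasDerivAt (fun t : ℝ => f (V₀ + t • v) - t * l v) (fderiv ℝ f V₀ v - l v) 0 := by
    have hf' : HasFDerivAt f (fderiv ℝ f V₀) (V₀ + (0 : ℝ) • v) := by simpa using hf.hasFDerivAt
    have := (hf'.comp_hasDerivAt (0 : ℝ) hline).sub ((hasDerivAt_id (0 : ℝ)).mul_const (l v))
    rw [one_mul] at this
    exact this
  have hmin : IsLocalMin (fun t : ℝ => f (V₀ + t • v) - t * l v) 0 := by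
    have hc : Tendsto (fun t : ℝ => V₀ + t • v) (𝓝 0) (𝓝 V₀) := by
      simpa using hline.continuousAt.tendsto
    filter_upwards [hc.eventually h] with t ht
    rw [add_sub_cancel_left, hl] at ht
    simp; linarith
  exact sub_eq_zero.1 (hmin.hasDerivAt_eq_zero hg)

/-- A continuous family of lower supports is the derivative. -/
lemma hasFDerivAt_of_support {f : E → ℝ} {L : E → E →L[ℝ] ℝ} {U : Set E} (hU : IsOpen U)
    (hL : ∀ V ∈ U, ContinuousAt L V)
    (h : ∀ V ∈ U, ∀ V₀ ∈ U, f V₀ + L V₀ (V - V₀) ≤ f V) {V₀ : E} (hV₀ : V₀ ∈ U) :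
    HasFDerivAt f (L V₀) V₀ := by
  rw [hasFDerivAt_iff_isLittleO, Asymptotics.isLittleO_iff]
  intro c hc
  have h1 : ∀ᶠ V in 𝓝 V₀, ‖L V - L V₀‖ < c := by
    have := (hL V₀ hV₀).tendsto.eventually (Metric.ball_mem_nhds (L V₀) hc)
    filter_upwards [this] with V hV
    rwa [← dist_eq_norm]
  filter_upwards [h1, hU.mem_nhds hV₀] with V hV hVU
  -- The supports at V₀ and at V squeeze the remainder between 0 and (L V - L V₀)(V - V₀).
  have ha := h V hVU V₀ hV₀
  have hb := h V₀ hV₀ V hVU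
  have e : L V (V₀ - V) = - L V (V - V₀) := by rw [← map_neg, neg_sub]
  have hn : (L V - L V₀) (V - V₀) ≤ c * ‖V - V₀‖ :=
    (Real.le_norm_self _).trans (((L V - L V₀).le_opNorm _).trans (by gcongr))
  rw [_root_.sub_apply] at hn
  rw [Real.norm_of_nonneg (by linarith)]
  linarith

lemma contDiffAt_one_of_support {f : E → ℝ} {L : E → E →L[ℝ] ℝ} {U : Set E} (hU : IsOpen U)
    (hL : ∀ V ∈ U, ContinuousAt L V)
    (h : ∀ V ∈ U, ∀ V₀ ∈ U, f V₀ + L V₀ (V - V₀) ≤ f V) {V₀ : E} (hV₀ : V₀ ∈ U) :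
    ContDiffAt ℝ 1 f V₀ := by
  rw [contDiffAt_one_iff]
  exact ⟨L, U, hU.mem_nhds hV₀, fun V hV => (hL V hV).continuousWithinAt,
    fun V hV => hasFDerivAt_of_support hU hL h hV⟩

lemma le_of_hasDerivAt {g : ℝ → ℝ} {g' c : ℝ} (hg : HasDerivAt g g' 0)
    (h : ∀ᶠ t in 𝓝[>] (0 : ℝ), c * t ≤ g t - g 0) : c ≤ g' := by
  have := (hasDerivAt_iff_tendsto_slope.1 hg).mono_left
    (nhdsWithin_mono 0 (fun t (ht : t ∈ Set.Ioi (0 : ℝ)) => (Set.mem_Ioi.1 ht).ne'))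
  refine ge_of_tendsto this ?_
  filter_upwards [h, self_mem_nhdsWithin] with t ht ht0
  rw [slope_def_field, sub_zero, le_div_iff₀ ht0]
  exact ht

lemma hasDerivAt_line {F : E → E →L[ℝ] ℝ} {V : E} (hF : DifferentiableAt ℝ F V) (d : E) :
    HasDerivAt (fun t : ℝ => F (V + t • d) d) (fderiv ℝ F V d d) 0 := by
  have hline : HasDerivAt (fun t : ℝ => V + t • d) d 0 := by
    simpa using ((hasDerivAt_id (0 : ℝ)).smul_const d).const_add V
  have hF' : HasFDerivAt F (fderiv ℝ F V) (V + (0 : ℝ) • d) := by simpa using hF.hasFDerivAt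
  exact ((ContinuousLinearMap.apply ℝ ℝ d).hasFDerivAt (x := F (V + (0 : ℝ) • d))).comp_hasDerivAt
    (0 : ℝ) (hF'.comp_hasDerivAt (0 : ℝ) hline)

/-- A two-point lower bound on the convexity defect passes to the second derivative. -/
lemma le_fderiv_fderiv {f : E → ℝ} {V : E} (hf : ContDiffAt ℝ 2 f V) {U : Set E} (hU : U ∈ 𝓝 V)
    {q : E → ℝ} (hq : ∀ (c : ℝ) v, q (c • v) = c ^ 2 * q v)
    (h : ∀ W ∈ U, ∀ W₀ ∈ U, q (W - W₀) ≤ f W - f W₀ - fderiv ℝ f W₀ (W - W₀)) (d : E) :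
    2 * q d ≤ fderiv ℝ (fderiv ℝ f) V d d := by
  have hd : DifferentiableAt ℝ (fderiv ℝ f) V :=
    (hf.fderiv_right (m := 1) (by norm_num)).differentiableAt (by norm_num)
  refine le_of_hasDerivAt (hasDerivAt_line hd d) ?_
  have hc : Tendsto (fun t : ℝ => V + t • d) (𝓝[>] 0) (𝓝 V) := by
    have : ContinuousAt (fun t : ℝ => V + t • d) 0 := by fun_prop
    have := this.tendsto
    rw [zero_smul, add_zero] at this
    exact this.mono_left nhdsWithin_le_nhds
  filter_upwards [hc.eventually hU, self_mem_nhdsWithin] with t ht ht0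
  have hpos : 0 < t := ht0
  -- Adding the inequality in both orders leaves only the increment of the gradient, and produces
  -- the factor 2.
  have h1 := h _ ht _ (mem_of_mem_nhds hU)
  have h2 := h _ (mem_of_mem_nhds hU) _ ht
  have e1 : V + t • d - V = t • d := by abel
  have e2 : V - (V + t • d) = (-t) • d := by rw [neg_smul]; abel
  rw [e1, hq, map_smul, smul_eq_mul] at h1
  rw [e2, hq, map_smul, smul_eq_mul] at h2
  rw [zero_smul, add_zero]
  have : t * (2 * q d * t) ≤ t * (fderiv ℝ f (V + t • d) d - fderiv ℝ f V d) := by linarith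
  exact le_of_mul_le_mul_left this hpos

/-- A Lipschitz bound on the gradient passes to the second derivative. -/
lemma abs_fderiv_fderiv_le {f : E → ℝ} {x : E} (hf : ContDiffAt ℝ 2 f x) {C : ℝ} (hC : 0 ≤ C)
    (h : ∀ x' d : E, |fderiv ℝ f x' d - fderiv ℝ f x d| ≤ C * ‖x' - x‖ * ‖d‖) (d : E) :
    |fderiv ℝ (fderiv ℝ f) x d d| ≤ C * ‖d‖ ^ 2 := by
  have hd : DifferentiableAt ℝ (fderiv ℝ f) x :=
    (hf.fderiv_right (m := 1) (by norm_num)).differentiableAt (by norm_num)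
  refine (hasDerivAt_line hd d).le_of_lip' (by positivity) (Eventually.of_forall fun t => ?_)
  have := h (x + t • d) d
  rw [add_sub_cancel_left, norm_smul] at this
  rw [zero_smul, add_zero, sub_zero, Real.norm_eq_abs]
  linarith

end Calculus

/-! ### Smoothness of the constituents off the cuts. -/

section Smooth

variable {H : Type*} [NormedAddCommGroup H]

/-- The open region `1/2 < rs < 2Q` in the variables `V = (x, y, r, s)`. -/
def extDomain (H : Type*) (Q : ℝ) : Set (H × H × ℝ × ℝ) :=
  {V | Admissible Q V.2.2.1 V.2.2.2}

lemma isOpen_extDomain {Q : ℝ} (hQ : 1 ≤ Q) : IsOpen (extDomain H Q) := by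
  have e : extDomain H Q = {V | 0 < V.2.2.1} ∩ {V | 0 < V.2.2.2} ∩
      {V | 1 / 2 < V.2.2.1 * V.2.2.2} ∩ {V | V.2.2.1 * V.2.2.2 < 2 * Q} := by
    ext V
    exact ⟨fun h => ⟨⟨⟨h.r_pos, h.s_pos⟩, h.half_lt⟩, h.lt_two_mul⟩,
      fun h => ⟨hQ, h.1.1.1, h.1.1.2, h.1.2, h.2⟩⟩
  rw [e]
  exact (((isOpen_lt (by fun_prop) (by fun_prop)).inter (isOpen_lt (by fun_prop) (by fun_prop))).inter
    (isOpen_lt (by fun_prop) (by fun_prop))).inter (isOpen_lt (by fun_prop) (by fun_prop))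

lemma domain_subset_extDomain {H : Type*} {Q : ℝ} (hQ : 1 ≤ Q) : domain H Q ⊆ extDomain H Q :=
  fun _ hV => ⟨hQ, hV.1, hV.2.1, by linarith [hV.2.2.1], by linarith [hV.2.2.2]⟩

variable {Q : ℝ} {V : H × H × ℝ × ℝ}

lemma continuous_K (Q : ℝ) : Continuous (fun V : H × H × ℝ × ℝ => K Q V.2.2.1 V.2.2.2) := by
  unfold K
  fun_prop

/-- The region where the supremum in `B₄` is reached as `a → 0`. -/
def leftRegion (H : Type*) [NormedAddCommGroup H] (Q : ℝ) : Set (H × H × ℝ × ℝ) :=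
  {V | ‖V.2.1‖ * V.2.2.1 < ‖V.1‖ * K Q V.2.2.1 V.2.2.2}

/-- The region where the supremum in `B₄` is reached as `a → ∞`. -/
def rightRegion (H : Type*) [NormedAddCommGroup H] (Q : ℝ) : Set (H × H × ℝ × ℝ) :=
  {V | ‖V.1‖ * V.2.2.2 < ‖V.2.1‖ * K Q V.2.2.1 V.2.2.2}

/-- The region where the supremum in `B₄` is attained. -/
def centerRegion (H : Type*) [NormedAddCommGroup H] (Q : ℝ) : Set (H × H × ℝ × ℝ) :=
  {V | ‖V.1‖ * K Q V.2.2.1 V.2.2.2 < ‖V.2.1‖ * V.2.2.1 ∧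
    ‖V.2.1‖ * K Q V.2.2.1 V.2.2.2 < ‖V.1‖ * V.2.2.2}

lemma isOpen_leftRegion (Q : ℝ) : IsOpen (leftRegion H Q) :=
  have := continuous_K (H := H) Q
  isOpen_lt (by fun_prop) (by fun_prop)

lemma isOpen_rightRegion (Q : ℝ) : IsOpen (rightRegion H Q) :=
  have := continuous_K (H := H) Q
  isOpen_lt (by fun_prop) (by fun_prop)

lemma isOpen_centerRegion (Q : ℝ) : IsOpen (centerRegion H Q) := by
  have := continuous_K (H := H) Q
  rw [centerRegion, Set.ofPred_and]
  exact (isOpen_lt (by fun_prop) (by fun_prop)).inter (isOpen_lt (by fun_prop) (by fun_prop))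

lemma leftRegion_disjoint_rightRegion (hV : V ∈ extDomain H Q) (h : V ∈ leftRegion H Q) :
    V ∉ rightRegion H Q := by
  intro h'
  have h1 : ‖V.2.1‖ * V.2.2.1 < ‖V.1‖ * K Q V.2.2.1 V.2.2.2 := h
  have h2 : ‖V.1‖ * V.2.2.2 < ‖V.2.1‖ * K Q V.2.2.1 V.2.2.2 := h'
  have hK := hV.K_pos
  have hr := hV.r_pos
  have hs := hV.s_pos
  have h3 := hV.K_sq_lt
  have hx : 0 ≤ ‖V.1‖ := norm_nonneg _
  have hy : 0 ≤ ‖V.2.1‖ := norm_nonneg _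
  have h4 : ‖V.1‖ * V.2.2.2 * V.2.2.1 ≤ ‖V.1‖ * K Q V.2.2.1 V.2.2.2 * K Q V.2.2.1 V.2.2.2 := by
    nlinarith
  have hx' : 0 < ‖V.1‖ := by
    rcases hx.eq_or_lt with e | e
    · rw [← e, zero_mul] at h1
      exact absurd h1 (not_lt.2 (by positivity))
    · exact e
  nlinarith

variable [InnerProductSpace ℝ H] {n : WithTop ℕ∞}

lemma contDiffAt_sqrt (hV : V ∈ extDomain H Q) :
    ContDiffAt ℝ n (fun V : H × H × ℝ × ℝ => √(V.2.2.1 * V.2.2.2)) V :=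
  ContDiffAt.sqrt (by fun_prop) (mul_pos hV.r_pos hV.s_pos).ne'

lemma contDiffAt_K (hV : V ∈ extDomain H Q) :
    ContDiffAt ℝ n (fun V : H × H × ℝ × ℝ => K Q V.2.2.1 V.2.2.2) V := by
  have := contDiffAt_sqrt (n := n) hV
  unfold K
  fun_prop

lemma contDiffAt_N (hV : V ∈ extDomain H Q) :
    ContDiffAt ℝ n (fun V : H × H × ℝ × ℝ => N Q V.2.2.1 V.2.2.2) V := by
  have := contDiffAt_sqrt (n := n) hV
  unfold N
  fun_prop

lemma contDiffAt_normSq_div {f : H × H × ℝ × ℝ → H} {g : H × H × ℝ × ℝ → ℝ}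
    (hf : ContDiffAt ℝ n f V) (hg : ContDiffAt ℝ n g V) (h0 : g V ≠ 0) :
    ContDiffAt ℝ n (fun V => ‖f V‖ ^ 2 / g V) V :=
  (hf.norm_sq ℝ).div hg h0

lemma contDiffAt_M {f : H × H × ℝ × ℝ → ℝ} (hV : V ∈ extDomain H Q) (hf : ContDiffAt ℝ n f V)
    (h : 0 < f V) :
    ContDiffAt ℝ n (fun V : H × H × ℝ × ℝ => M V.2.2.1 V.2.2.2 (f V + 1)) V ∧
    ContDiffAt ℝ n (fun V : H × H × ℝ × ℝ => M V.2.2.2 V.2.2.1 (f V + 1)) V := by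
  have hr := hV.r_pos
  have hs := hV.s_pos
  unfold M
  constructor
  · exact (by fun_prop : ContDiffAt ℝ n (fun V : H × H × ℝ × ℝ => 2 * V.2.2.1) V).sub
      (ContDiffAt.div (by fun_prop) (by fun_prop) (by positivity))
  · exact (by fun_prop : ContDiffAt ℝ n (fun V : H × H × ℝ × ℝ => 2 * V.2.2.2) V).sub
      (ContDiffAt.div (by fun_prop) (by fun_prop) (by positivity))

lemma contDiffAt_B₁ (hV : V ∈ extDomain H Q) : ContDiffAt ℝ n (B₁ (H := H)) V :=
  (contDiffAt_normSq_div (f := fun V => V.1) (g := fun V => V.2.2.1) (by fun_prop) (by fun_prop)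
    hV.r_pos.ne').add
  (contDiffAt_normSq_div (f := fun V => V.2.1) (g := fun V => V.2.2.2) (by fun_prop) (by fun_prop)
    hV.s_pos.ne')

lemma contDiffAt_of_M {f : H × H × ℝ × ℝ → ℝ} (hV : V ∈ extDomain H Q)
    (hf : ContDiffAt ℝ n f V) (h : 0 < f V) :
    ContDiffAt ℝ n (fun V => ‖V.1‖ ^ 2 / M V.2.2.1 V.2.2.2 (f V + 1) + ‖V.2.1‖ ^ 2 / V.2.2.2) V ∧
    ContDiffAt ℝ n (fun V => ‖V.1‖ ^ 2 / V.2.2.1 + ‖V.2.1‖ ^ 2 / M V.2.2.2 V.2.2.1 (f V + 1)) V := by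
  obtain ⟨h1, h2⟩ := contDiffAt_M hV hf h
  have h3 : 1 ≤ f V + 1 := by linarith
  exact ⟨(contDiffAt_normSq_div (by fun_prop) h1 (M_pos hV h3).ne').add
    (contDiffAt_normSq_div (by fun_prop) (by fun_prop) hV.s_pos.ne'),
    (contDiffAt_normSq_div (by fun_prop) (by fun_prop) hV.r_pos.ne').add
    (contDiffAt_normSq_div (by fun_prop) h2 (M_pos hV.symm h3).ne')⟩

lemma contDiffAt_B₂ (hV : V ∈ extDomain H Q) : ContDiffAt ℝ n (B₂ (H := H) Q) V :=
  (contDiffAt_of_M hV (contDiffAt_N hV) hV.N_pos).1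

lemma contDiffAt_B₃ (hV : V ∈ extDomain H Q) : ContDiffAt ℝ n (B₃ (H := H) Q) V :=
  (contDiffAt_of_M hV (contDiffAt_N hV) hV.N_pos).2

lemma contDiffAt_B₅ (hV : V ∈ extDomain H Q) : ContDiffAt ℝ n (B₅ (H := H) Q) V :=
  (contDiffAt_of_M hV (contDiffAt_K hV) hV.K_pos).1

lemma contDiffAt_B₆ (hV : V ∈ extDomain H Q) : ContDiffAt ℝ n (B₆ (H := H) Q) V :=
  (contDiffAt_of_M hV (contDiffAt_K hV) hV.K_pos).2

/-- `B` is as smooth as its only nonsmooth constituent `B₄`. -/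
lemma contDiffAt_B (c₁ c₂ c₃ c₇ : ℝ) (hV : V ∈ extDomain H Q)
    (h : ContDiffAt ℝ n (B₄ (H := H) Q) V) : ContDiffAt ℝ n (B (H := H) c₁ c₂ c₃ c₇ Q) V := by
  have h1 := contDiffAt_B₁ (n := n) hV
  have h2 := contDiffAt_B₂ (n := n) hV
  have h3 := contDiffAt_B₃ (n := n) hV
  have h5 := contDiffAt_B₅ (n := n) hV
  have h6 := contDiffAt_B₆ (n := n) hV
  unfold B B₇
  fun_prop

lemma contDiffAt_B₄_left (hV : V ∈ extDomain H Q) (h : V ∈ leftRegion H Q) :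
    ContDiffAt ℝ n (B₄ (H := H) Q) V := by
  have h1 : ContDiffAt ℝ n (fun V : H × H × ℝ × ℝ => ‖V.1‖ ^ 2 / V.2.2.1) V :=
    contDiffAt_normSq_div (by fun_prop) (by fun_prop) hV.r_pos.ne'
  refine h1.congr_of_eventuallyEq ?_
  filter_upwards [(isOpen_extDomain hV.one_le).mem_nhds hV, (isOpen_leftRegion Q).mem_nhds h]
    with W hW hW'
  exact H₄_eq_left W.1 W.2.1 hW.r_pos hW.s_pos hW.K_pos.le hW.K_sq_lt (le_of_lt hW')

lemma contDiffAt_B₄_right (hV : V ∈ extDomain H Q) (h : V ∈ rightRegion H Q) :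
    ContDiffAt ℝ n (B₄ (H := H) Q) V := by
  have h1 : ContDiffAt ℝ n (fun V : H × H × ℝ × ℝ => ‖V.2.1‖ ^ 2 / V.2.2.2) V :=
    contDiffAt_normSq_div (by fun_prop) (by fun_prop) hV.s_pos.ne'
  refine h1.congr_of_eventuallyEq ?_
  filter_upwards [(isOpen_extDomain hV.one_le).mem_nhds hV, (isOpen_rightRegion Q).mem_nhds h]
    with W hW hW'
  exact H₄_eq_right W.1 W.2.1 hW.r_pos hW.s_pos hW.K_pos.le hW.K_sq_lt (le_of_lt hW')

lemma contDiffAt_B₄_center (hV : V ∈ extDomain H Q) (h : V ∈ centerRegion H Q) :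
    ContDiffAt ℝ n (B₄ (H := H) Q) V := by
  have hK := contDiffAt_K (n := n) hV
  -- In the central region both vectors are nonzero, so the norms themselves, and not only their
  -- squares, are smooth.
  have hx : V.1 ≠ 0 := by
    intro h0
    have := h.2
    rw [h0, norm_zero, zero_mul] at this
    exact absurd this (not_lt.2 (mul_nonneg (norm_nonneg _) hV.K_pos.le))
  have hy : V.2.1 ≠ 0 := by
    intro h0
    have := h.1
    rw [h0, norm_zero, zero_mul] at this
    exact absurd this (not_lt.2 (mul_nonneg (norm_nonneg _) hV.K_pos.le))
  have hX : ContDiffAt ℝ n (fun V : H × H × ℝ × ℝ => ‖V.1‖) V :=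
    ContDiffAt.norm ℝ (by fun_prop) hx
  have hY : ContDiffAt ℝ n (fun V : H × H × ℝ × ℝ => ‖V.2.1‖) V :=
    ContDiffAt.norm ℝ (by fun_prop) hy
  have h1 : ContDiffAt ℝ n (fun V : H × H × ℝ × ℝ =>
      (V.2.2.2 * ‖V.1‖ ^ 2 + V.2.2.1 * ‖V.2.1‖ ^ 2 - 2 * K Q V.2.2.1 V.2.2.2 * ‖V.1‖ * ‖V.2.1‖) /
        (V.2.2.1 * V.2.2.2 - K Q V.2.2.1 V.2.2.2 ^ 2)) V :=
    ContDiffAt.div (by fun_prop) (by fun_prop) (sub_pos.2 hV.K_sq_lt).ne'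
  refine h1.congr_of_eventuallyEq ?_
  filter_upwards [(isOpen_extDomain hV.one_le).mem_nhds hV, (isOpen_centerRegion Q).mem_nhds h]
    with W hW hW'
  exact H₄_eq_center W.1 W.2.1 hW.r_pos hW.s_pos hW.K_pos.le hW.K_sq_lt (le_of_lt hW'.1)
    (le_of_lt hW'.2)

lemma contDiffAt_B₄_of_ne (hV : V ∈ extDomain H Q)
    (h : ‖V.2.1‖ * V.2.2.1 ≠ ‖V.1‖ * K Q V.2.2.1 V.2.2.2)
    (h' : ‖V.1‖ * V.2.2.2 ≠ ‖V.2.1‖ * K Q V.2.2.1 V.2.2.2) :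
    ContDiffAt ℝ n (B₄ (H := H) Q) V := by
  rcases h.lt_or_gt with h1 | h1
  · exact contDiffAt_B₄_left hV h1
  rcases h'.lt_or_gt with h2 | h2
  · exact contDiffAt_B₄_right hV h2
  · exact contDiffAt_B₄_center hV ⟨h1, h2⟩

end Smooth

lemma B₃_swap {H : Type*} [NormedAddCommGroup H] (x y : H) (Q r s : ℝ) :
    B₃ Q (x, y, r, s) = B₂ Q (y, x, s, r) := by
  rw [B₃, B₂, N_comm, add_comm]

lemma B₆_swap {H : Type*} [NormedAddCommGroup H] (x y : H) (Q r s : ℝ) :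
    B₆ Q (x, y, r, s) = B₅ Q (y, x, s, r) := by
  rw [B₆, B₅, K_comm, add_comm]

/-! ### Two-point convexity of each constituent. -/

section Support

variable {H : Type*} [NormedAddCommGroup H] [InnerProductSpace ℝ H]

/-- The differential of `‖x‖² / m` at `(x₀, m₀)`. -/
def dQuad (x₀ : H) (m₀ : ℝ) (dx : H) (dm : ℝ) : ℝ :=
  2 * inner ℝ (m₀⁻¹ • x₀) dx - (‖x₀‖ / m₀) ^ 2 * dm

lemma dQuad_smul (x₀ : H) (m₀ c : ℝ) (dx : H) (dm : ℝ) :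
    dQuad x₀ m₀ (c • dx) (c * dm) = c * dQuad x₀ m₀ dx dm := by
  rw [dQuad, dQuad, inner_smul_right]; ring

/-- Completing the square. Here dm is any proposed increment of the denominator; when m is a concave
function of the weights and dm its differential, the last term is a nonnegative gain. -/
lemma quad_defect (x x₀ : H) {m m₀ : ℝ} (dm : ℝ) (hm : 0 < m) (hm₀ : 0 < m₀) :
    ‖x‖ ^ 2 / m = ‖x₀‖ ^ 2 / m₀ + dQuad x₀ m₀ (x - x₀) dm + ‖x - m • (m₀⁻¹ • x₀)‖ ^ 2 / m +
      (‖x₀‖ / m₀) ^ 2 * (m₀ + dm - m) := by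
  have h := norm_sub_sq_real x (m • (m₀⁻¹ • x₀))
  rw [h, dQuad, inner_sub_right, inner_smul_right, norm_smul, norm_smul, Real.norm_of_nonneg hm.le,
    Real.norm_of_nonneg (inv_pos.2 hm₀).le, inner_smul_right, real_inner_smul_left,
    real_inner_smul_left, real_inner_self_eq_norm_sq, real_inner_comm x x₀]
  field_simp
  ring

lemma quad_defect_le (x x₀ : H) {m m₀ : ℝ} (dm : ℝ) (hm : 0 < m) (hm₀ : 0 < m₀) :
    ‖x₀‖ ^ 2 / m₀ + dQuad x₀ m₀ (x - x₀) dm + (‖x₀‖ / m₀) ^ 2 * (m₀ + dm - m) ≤ ‖x‖ ^ 2 / m := by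
  have := quad_defect x x₀ dm hm hm₀
  have h2 : 0 ≤ ‖x - m • (m₀⁻¹ • x₀)‖ ^ 2 / m := by positivity
  linarith

/-- The differential of `‖x‖² / r + ‖y‖² / s`. -/
def dB₁ (x y : H) (r s : ℝ) (dx dy : H) (dr ds : ℝ) : ℝ := dQuad x r dx dr + dQuad y s dy ds

/-- The differential of `‖x‖² / M(r, s, z) + ‖y‖² / s`. -/
def dBM (x y : H) (r s z : ℝ) (dx dy : H) (dr ds dz : ℝ) : ℝ :=
  dQuad x (M r s z) dx (dM s z dr ds dz) + dQuad y s dy ds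

/-- The differential of `B₄`, by the envelope principle. -/
def dB₄ (Q : ℝ) (x y : H) (r s : ℝ) (dx dy : H) (dr ds : ℝ) : ℝ :=
  2 * inner ℝ (optVec x y r s (K Q r s)) dx + 2 * inner ℝ (optVec y x s r (K Q r s)) dy
    - dr * ‖optVec x y r s (K Q r s)‖ ^ 2 - ds * ‖optVec y x s r (K Q r s)‖ ^ 2
    - 2 * dK Q r s dr ds * (‖optVec x y r s (K Q r s)‖ * ‖optVec y x s r (K Q r s)‖)

/-- The differential of `B₇`. -/
def dB₇ (Q : ℝ) (x y : H) (r s : ℝ) (dx dy : H) (dr ds : ℝ) : ℝ :=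
  dB₄ Q x y r s dx dy dr ds + dBM x y r s (K Q r s + 1) dx dy dr ds (dK Q r s dr ds) +
    dBM y x s r (K Q r s + 1) dy dx ds dr (dK Q r s dr ds)

/-- The differential of `B`. -/
def dB (c₁ c₂ c₃ c₇ Q : ℝ) (x y : H) (r s : ℝ) (dx dy : H) (dr ds : ℝ) : ℝ :=
  c₁ * dB₁ x y r s dx dy dr ds + c₂ * dBM x y r s (N Q r s + 1) dx dy dr ds (dN Q r s dr ds) +
    c₃ * dBM y x s r (N Q r s + 1) dy dx ds dr (dN Q r s dr ds) + c₇ * dB₇ Q x y r s dx dy dr ds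

lemma dM_smul (s z c dr ds dz : ℝ) : dM s z (c * dr) (c * ds) (c * dz) = c * dM s z dr ds dz := by
  rw [dM, dM]; ring

lemma dBM_smul (x y : H) (r s z c : ℝ) (dx dy : H) (dr ds dz : ℝ) :
    dBM x y r s z (c • dx) (c • dy) (c * dr) (c * ds) (c * dz) = c * dBM x y r s z dx dy dr ds dz := by
  rw [dBM, dBM, dM_smul, dQuad_smul, dQuad_smul]; ring

lemma dB_smul (c₁ c₂ c₃ c₇ Q : ℝ) (x y : H) (r s c : ℝ) (dx dy : H) (dr ds : ℝ) :
    dB c₁ c₂ c₃ c₇ Q x y r s (c • dx) (c • dy) (c * dr) (c * ds) =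
      c * dB c₁ c₂ c₃ c₇ Q x y r s dx dy dr ds := by
  simp only [dB, dB₇, dB₁, dB₄, dK_smul, dN_smul, dBM_smul, dQuad_smul, inner_smul_right]
  ring

variable {Q r s r₀ s₀ : ℝ} (x y x₀ y₀ : H)

lemma B₁_defect (h₀ : Admissible Q r₀ s₀) (h : Admissible Q r s) :
    B₁ (x₀, y₀, r₀, s₀) + dB₁ x₀ y₀ r₀ s₀ (x - x₀) (y - y₀) (r - r₀) (s - s₀) +
      (‖x - r • (r₀⁻¹ • x₀)‖ ^ 2 / r + ‖y - s • (s₀⁻¹ • y₀)‖ ^ 2 / s) = B₁ (x, y, r, s) := by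
  have h1 := quad_defect x x₀ (r - r₀) h.r_pos h₀.r_pos
  have h2 := quad_defect y y₀ (s - s₀) h.s_pos h₀.s_pos
  rw [add_sub_cancel, sub_self, mul_zero, add_zero] at h1 h2
  simp only [B₁, dB₁]
  rw [h1, h2]; ring

lemma BM_defect {z z₀ dz G : ℝ} (h₀ : Admissible Q r₀ s₀) (h : Admissible Q r s) (hz₀ : 1 ≤ z₀)
    (hz : 1 ≤ z) (hG0 : 0 ≤ G)
    (hG : G ≤ M r₀ s₀ z₀ + dM s₀ z₀ (r - r₀) (s - s₀) dz - M r s z) :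
    ‖x₀‖ ^ 2 / M r₀ s₀ z₀ + ‖y₀‖ ^ 2 / s₀ +
      dBM x₀ y₀ r₀ s₀ z₀ (x - x₀) (y - y₀) (r - r₀) (s - s₀) dz + (‖x₀‖ / r₀) ^ 2 * G / 4 ≤
      ‖x‖ ^ 2 / M r s z + ‖y‖ ^ 2 / s := by
  have h1 := quad_defect_le x x₀ (dM s₀ z₀ (r - r₀) (s - s₀) dz) (M_pos h hz) (M_pos h₀ hz₀)
  have h2 := quad_defect_le y y₀ (s - s₀) h.s_pos h₀.s_pos
  rw [add_sub_cancel, sub_self, mul_zero, add_zero] at h2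
  have hr₀ := h₀.r_pos
  -- The loss of 4 comes from M ≤ 2r.
  have h3 : (‖x₀‖ / r₀) ^ 2 / 4 ≤ (‖x₀‖ / M r₀ s₀ z₀) ^ 2 := by
    have : ‖x₀‖ / (2 * r₀) ≤ ‖x₀‖ / M r₀ s₀ z₀ :=
      div_le_div_of_nonneg_left (norm_nonneg _) (M_pos h₀ hz₀) (M_le h₀ hz₀)
    have e : (‖x₀‖ / r₀) ^ 2 / 4 = (‖x₀‖ / (2 * r₀)) ^ 2 := by field_simp; norm_num
    rw [e]
    gcongr
  have h4 : (‖x₀‖ / r₀) ^ 2 / 4 * G ≤ (‖x₀‖ / M r₀ s₀ z₀) ^ 2 *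
      (M r₀ s₀ z₀ + dM s₀ z₀ (r - r₀) (s - s₀) dz - M r s z) := by
    gcongr
  rw [dBM]
  linarith

lemma B₂_defect (h₀ : Admissible Q r₀ s₀) (h : Admissible Q r s) :
    B₂ Q (x₀, y₀, r₀, s₀) + dBM x₀ y₀ r₀ s₀ (N Q r₀ s₀ + 1) (x - x₀) (y - y₀) (r - r₀) (s - s₀)
      (dN Q r₀ s₀ (r - r₀) (s - s₀)) + (‖x₀‖ / r₀) ^ 2 * (s * (r - r₀) ^ 2 / Q ^ 2) / 124416 ≤
      B₂ Q (x, y, r, s) := by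
  have hs := h.s_pos
  have h1 := M_N_defect h₀ h
  have h2 := BM_defect (z := N Q r s + 1) (z₀ := N Q r₀ s₀ + 1)
    (dz := dN Q r₀ s₀ (r - r₀) (s - s₀)) (G := s * (r - r₀) ^ 2 / Q ^ 2 / 31104) x y x₀ y₀ h₀ h (by linarith [h₀.N_pos])
    (by linarith [h.N_pos]) (by positivity) (by linarith)
  refine le_trans (le_of_eq ?_) h2
  rw [B₂, M]
  ring

lemma B₅_defect (h₀ : Admissible Q r₀ s₀) (h : Admissible Q r s) :
    B₅ Q (x₀, y₀, r₀, s₀) + dBM x₀ y₀ r₀ s₀ (K Q r₀ s₀ + 1) (x - x₀) (y - y₀) (r - r₀) (s - s₀)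
      (dK Q r₀ s₀ (r - r₀) (s - s₀)) +
      (‖x₀‖ / r₀) ^ 2 * (|r - r₀| * |s - s₀| / Q) / (288 * s₀) ≤ B₅ Q (x, y, r, s) := by
  have hs₀ := h₀.s_pos
  have hQ := h.Q_pos
  have h1 := M_K_defect h₀ h
  have h3 := K_defect h₀ h
  have h4 : |r - r₀| * |s - s₀| / Q / 8 / (9 * s₀) ≤
    (K Q r₀ s₀ + dK Q r₀ s₀ (r - r₀) (s - s₀) - K Q r s) / (9 * s₀) := by
    apply div_le_div_of_nonneg_right _ (by positivity)
    linarith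
  have h2 := BM_defect (z := K Q r s + 1) (z₀ := K Q r₀ s₀ + 1)
    (G := |r - r₀| * |s - s₀| / Q / 8 / (9 * s₀)) x y x₀ y₀ h₀ h (by linarith [h₀.K_pos])
    (by linarith [h.K_pos]) (by positivity) (h4.trans h1)
  refine le_trans (le_of_eq ?_) h2
  -- 288 = 8 · 9 · 4, from `K_defect`, `M_K_defect` and `BM_defect`.
  have e : (‖x₀‖ / r₀) ^ 2 * (|r - r₀| * |s - s₀| / Q) / (288 * s₀) =
      (‖x₀‖ / r₀) ^ 2 * (|r - r₀| * |s - s₀| / Q / 8 / (9 * s₀)) / 4 := by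
    field_simp; ring
  rw [e, B₅, M]

/-- The vectors optimal at the base point compete at the other point. The dual expression is affine,
so the only gain comes from replacing K by its linearisation: 2|a||b| times the defect of K, and 2/8
= 1/4. -/
lemma B₄_defect (h₀ : Admissible Q r₀ s₀) (h : Admissible Q r s) :
    B₄ Q (x₀, y₀, r₀, s₀) + dB₄ Q x₀ y₀ r₀ s₀ (x - x₀) (y - y₀) (r - r₀) (s - s₀) +
      optLen ‖x₀‖ ‖y₀‖ r₀ s₀ (K Q r₀ s₀) * optLen ‖y₀‖ ‖x₀‖ s₀ r₀ (K Q r₀ s₀) *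
        (|r - r₀| * |s - s₀| / Q) / 4 ≤ B₄ Q (x, y, r, s) := by
  have h1 := dual_le_H₄ (optVec x₀ y₀ r₀ s₀ (K Q r₀ s₀)) (optVec y₀ x₀ s₀ r₀ (K Q r₀ s₀)) x y
    h.r_pos h.s_pos h.K_pos.le
  have h2 := H₄_eq_dual x₀ y₀ h₀.r_pos h₀.s_pos h₀.K_pos.le h₀.K_sq_lt
  have h3 := K_defect h₀ h
  have h4 := mul_nonneg (optLen_nonneg ‖x₀‖ ‖y₀‖ r₀ s₀ (K Q r₀ s₀))
    (optLen_nonneg ‖y₀‖ ‖x₀‖ s₀ r₀ (K Q r₀ s₀))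
  have h5 := mul_le_mul_of_nonneg_left h3 h4
  rw [B₄, B₄, dB₄, h2, inner_sub_right, inner_sub_right]
  rw [norm_optVec x₀ y₀ h₀.r_pos, norm_optVec y₀ x₀ h₀.s_pos] at *
  linarith

lemma B₇_defect (h₀ : Admissible Q r₀ s₀) (h : Admissible Q r s) :
    B₇ Q (x₀, y₀, r₀, s₀) + dB₇ Q x₀ y₀ r₀ s₀ (x - x₀) (y - y₀) (r - r₀) (s - s₀) +
      ‖x₀‖ / r₀ * (‖y₀‖ / s₀) * (|r - r₀| * |s - s₀| / Q) / 1152 ≤ B₇ Q (x, y, r, s) := by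
  have h4 := B₄_defect x y x₀ y₀ h₀ h
  have h5 := B₅_defect x y x₀ y₀ h₀ h
  have h6 := B₅_defect y x y₀ x₀ h₀.symm h.symm
  rw [← B₆_swap x y, ← B₆_swap x₀ y₀, K_comm, dK_comm, mul_comm |s - s₀|] at h6
  have hr₀ := h₀.r_pos
  have hs₀ := h₀.s_pos
  have hP : 0 ≤ |r - r₀| * |s - s₀| / Q := div_nonneg (by positivity) h.Q_pos.le
  have hk := h₀.K_pos
  have hk2 := h₀.K_le
  have hrs := h₀.K_sq_lt
  have hsr : K Q r₀ s₀ ^ 2 < s₀ * r₀ := by rwa [mul_comm s₀ r₀]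
  have hα : 0 ≤ ‖x₀‖ / r₀ := by positivity
  have hβ : 0 ≤ ‖y₀‖ / s₀ := by positivity
  have o1 := optLen_nonneg ‖x₀‖ ‖y₀‖ r₀ s₀ (K Q r₀ s₀)
  have o2 := optLen_nonneg ‖y₀‖ ‖x₀‖ s₀ r₀ (K Q r₀ s₀)
  have g4 : 0 ≤ optLen ‖x₀‖ ‖y₀‖ r₀ s₀ (K Q r₀ s₀) * optLen ‖y₀‖ ‖x₀‖ s₀ r₀ (K Q r₀ s₀) *
        (|r - r₀| * |s - s₀| / Q) / 4 := by positivity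
  have g5 : 0 ≤ (‖x₀‖ / r₀) ^ 2 * (|r - r₀| * |s - s₀| / Q) / (288 * s₀) := by positivity
  have g6 : 0 ≤ (‖y₀‖ / s₀) ^ 2 * (|r - r₀| * |s - s₀| / Q) / (288 * r₀) := by positivity
  have key : ‖x₀‖ / r₀ * (‖y₀‖ / s₀) * (|r - r₀| * |s - s₀| / Q) / 1152 ≤
      optLen ‖x₀‖ ‖y₀‖ r₀ s₀ (K Q r₀ s₀) * optLen ‖y₀‖ ‖x₀‖ s₀ r₀ (K Q r₀ s₀) *
        (|r - r₀| * |s - s₀| / Q) / 4 +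
      (‖x₀‖ / r₀) ^ 2 * (|r - r₀| * |s - s₀| / Q) / (288 * s₀) +
      (‖y₀‖ / s₀) ^ 2 * (|r - r₀| * |s - s₀| / Q) / (288 * r₀) := by
    generalize |r - r₀| * |s - s₀| / Q = P at *
    -- When one ratio is small relative to the other, K ≤ 2 turns the mixed product into a pure
    -- square; 1152 = 4 · 288.
    have small : ∀ {a b ρ : ℝ}, 0 < ρ → 0 ≤ a → 0 ≤ b → b ≤ 2 * K Q r₀ s₀ * a / ρ →
        a * b * P / 1152 ≤ a ^ 2 * P / (288 * ρ) := by
      intro a b ρ hρ ha hb hab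
      have h1 : b ≤ 4 * a / ρ := hab.trans (by gcongr; linarith)
      have h2 : a * b * P / 1152 ≤ a * (4 * a / ρ) * P / 1152 := by gcongr
      refine h2.trans (le_of_eq ?_)
      field_simp; ring
    -- If both comparisons hold, each optimal length is at least half of the unconstrained one and
    -- B₄ suffices. If the second fails, B₅ pays; if the first fails, B₆ pays.
    by_cases c1 : 2 * K Q r₀ s₀ * (‖y₀‖ / s₀) / r₀ ≤ ‖x₀‖ / r₀
    · by_cases c2 : 2 * K Q r₀ s₀ * (‖x₀‖ / r₀) / s₀ ≤ ‖y₀‖ / s₀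
      · have l1 := half_le_optLen (norm_nonneg x₀) hr₀ hs₀ hrs c1
        have l2 := half_le_optLen (norm_nonneg y₀) hs₀ hr₀ hsr c2
        have l3 := mul_le_mul l1 l2 (by positivity) o1
        have l4 := mul_le_mul_of_nonneg_right l3 hP
        have l5 : 0 ≤ ‖x₀‖ / r₀ * (‖y₀‖ / s₀) * P := by positivity
        linarith
      · have := small hs₀ hα hβ (not_le.1 c2).le
        linarith
    · have := small hr₀ hβ hα (not_le.1 c1).le
      rw [mul_comm (‖y₀‖ / s₀)] at this
      linarith
  rw [B₇, B₇, dB₇]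
  linarith

end Support

/-! ### Size of `B` and its two-point convexity. -/

section Main

variable {H : Type*} [NormedAddCommGroup H]

/-- Size of the constituents built on the denominator `M`. -/
lemma BM_bounds (x y : H) {r s z : ℝ} (hr : 0 < r) (hs : 0 < s) (hrs : 1 ≤ r * s) (hz : 1 ≤ z) :
    0 ≤ ‖x‖ ^ 2 / M r s z + ‖y‖ ^ 2 / s ∧
      ‖x‖ ^ 2 / M r s z + ‖y‖ ^ 2 / s ≤ ‖x‖ ^ 2 / r + ‖y‖ ^ 2 / s := by
  have hM := le_M hs hrs hz
  have hM0 := hr.trans_le hM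
  constructor
  · positivity
  · gcongr

lemma B_bounds {c₁ c₂ c₃ c₇ : ℝ} (h₁ : 0 ≤ c₁) (h₂ : 0 ≤ c₂) (h₃ : 0 ≤ c₃) (h₇ : 0 ≤ c₇)
    {Q : ℝ} (hQ : 1 ≤ Q) (x y : H) {r s : ℝ} (hV : (x, y, r, s) ∈ domain H Q) :
    0 ≤ B c₁ c₂ c₃ c₇ Q (x, y, r, s) ∧
      B c₁ c₂ c₃ c₇ Q (x, y, r, s) ≤
        (c₁ + c₂ + c₃ + 3 * c₇) * (‖x‖ ^ 2 / r + ‖y‖ ^ 2 / s) := by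
  have h : Admissible Q r s := domain_subset_extDomain hQ hV
  have hr := h.r_pos
  have hs := h.s_pos
  have hrs : 1 ≤ r * s := hV.2.2.1
  have hsr : 1 ≤ s * r := by rwa [mul_comm]
  have hN := h.N_pos
  have hK := h.K_pos
  obtain ⟨a2, b2⟩ : 0 ≤ B₂ Q (x, y, r, s) ∧ B₂ Q (x, y, r, s) ≤ ‖x‖ ^ 2 / r + ‖y‖ ^ 2 / s :=
    BM_bounds x y hr hs hrs (by linarith)
  obtain ⟨a5, b5⟩ : 0 ≤ B₅ Q (x, y, r, s) ∧ B₅ Q (x, y, r, s) ≤ ‖x‖ ^ 2 / r + ‖y‖ ^ 2 / s :=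
    BM_bounds x y hr hs hrs (by linarith)
  obtain ⟨a3, b3⟩ : 0 ≤ B₃ Q (x, y, r, s) ∧ B₃ Q (x, y, r, s) ≤ ‖x‖ ^ 2 / r + ‖y‖ ^ 2 / s := by
    rw [B₃_swap, add_comm (‖x‖ ^ 2 / r)]
    exact BM_bounds y x hs hr hsr (by rw [N_comm]; linarith)
  obtain ⟨a6, b6⟩ : 0 ≤ B₆ Q (x, y, r, s) ∧ B₆ Q (x, y, r, s) ≤ ‖x‖ ^ 2 / r + ‖y‖ ^ 2 / s := by
    rw [B₆_swap, add_comm (‖x‖ ^ 2 / r)]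
    exact BM_bounds y x hs hr hsr (by rw [K_comm]; linarith)
  have a4 : 0 ≤ B₄ Q (x, y, r, s) := H₄_nonneg x y hr hs hK.le
  have b4 : B₄ Q (x, y, r, s) ≤ ‖x‖ ^ 2 / r + ‖y‖ ^ 2 / s := H₄_le_add x y hr hs hK.le
  have e1 : B₁ (x, y, r, s) = ‖x‖ ^ 2 / r + ‖y‖ ^ 2 / s := rfl
  have a1 : 0 ≤ ‖x‖ ^ 2 / r + ‖y‖ ^ 2 / s := by positivity
  simp only [B, B₇, e1]
  constructor
  · positivity
  · have := mul_le_mul_of_nonneg_left b2 h₂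
    have := mul_le_mul_of_nonneg_left b3 h₃
    have := mul_le_mul_of_nonneg_left (add_le_add (add_le_add b4 b5) b6) h₇
    linarith

variable [InnerProductSpace ℝ H]

/-- Of the four products, the first three are handled by Young's inequality with weights r or s, and
the fourth is kept. Where r/Q² must be exchanged for 2/s, the bound rs < 2Q ≤ 2Q² enters. -/
lemma young_terms {Q r s ξ η α β ρ σ : ℝ} (h : Admissible Q r s) :
    2 / Q * ((ξ + ρ * α) * (η + σ * β)) ≤ 4 * (ξ ^ 2 / r + η ^ 2 / s) + α ^ 2 * (s * ρ ^ 2 / Q ^ 2) +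
      β ^ 2 * (r * σ ^ 2 / Q ^ 2) + 2 * (α * β * (ρ * σ / Q)) := by
  have hr := h.r_pos
  have hs := h.s_pos
  have hQ := h.Q_pos
  have am : ∀ {m : ℝ} (a b : ℝ), 0 < m → 2 / Q * (a * b) ≤ a ^ 2 / m + b ^ 2 * m / Q ^ 2 := by
    intro m a b hm
    have e : a ^ 2 / m + b ^ 2 * m / Q ^ 2 - 2 / Q * (a * b) = m * (a / m - b / Q) ^ 2 := by
      field_simp; ring
    have : 0 ≤ m * (a / m - b / Q) ^ 2 := by positivity
    linarith
  have h1 := am ξ η hr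
  have h2 := am ξ (σ * β) hr
  have h3 := am η (ρ * α) hs
  have h4 : η ^ 2 * r / Q ^ 2 ≤ 2 * (η ^ 2 / s) := by
    have hle : r / Q ^ 2 ≤ 2 / s := by
      rw [div_le_div_iff₀ (by positivity) hs]
      nlinarith [h.lt_two_mul, h.one_le]
    have := mul_le_mul_of_nonneg_left hle (sq_nonneg η)
    calc η ^ 2 * r / Q ^ 2 = η ^ 2 * (r / Q ^ 2) := by ring
      _ ≤ η ^ 2 * (2 / s) := this
      _ = _ := by ring
  have h5 : 0 ≤ ξ ^ 2 / r := by positivity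
  have h6 : 0 ≤ η ^ 2 / s := by positivity
  have e : 2 / Q * ((ξ + ρ * α) * (η + σ * β)) = 2 / Q * (ξ * η) + 2 / Q * (ξ * (σ * β)) +
      2 / Q * (η * (ρ * α)) + 2 * (α * β * (ρ * σ / Q)) := by ring
  have e2 : (σ * β) ^ 2 * r / Q ^ 2 = β ^ 2 * (r * σ ^ 2 / Q ^ 2) := by ring
  have e3 : (ρ * α) ^ 2 * s / Q ^ 2 = α ^ 2 * (s * ρ ^ 2 / Q ^ 2) := by ring
  rw [e]
  linarith

/-- One-leg convexity of `B` on the extended domain, with the explicit differential. -/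
lemma B_defect {Q r s r₀ s₀ : ℝ} (x y x₀ y₀ : H) (h₀ : Admissible Q r₀ s₀)
    (h : Admissible Q r s) :
    B 4 124416 124416 2304 Q (x₀, y₀, r₀, s₀) +
      dB 4 124416 124416 2304 Q x₀ y₀ r₀ s₀ (x - x₀) (y - y₀) (r - r₀) (s - s₀) +
      2 / Q * (‖x - x₀‖ * ‖y - y₀‖) ≤ B 4 124416 124416 2304 Q (x, y, r, s) := by
  have h1 := B₁_defect x y x₀ y₀ h₀ h
  have h2 := B₂_defect x y x₀ y₀ h₀ h
  have h3 := B₂_defect y x y₀ x₀ h₀.symm h.symm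
  have h7 := B₇_defect x y x₀ y₀ h₀ h
  rw [← B₃_swap x y, ← B₃_swap x₀ y₀, N_comm, dN_comm] at h3
  have hQ := h.Q_pos
  -- The increment is a remainder off the ray through u₀ plus a displacement along it.
  have hn : ∀ (u u₀ : H) {m m₀ : ℝ}, 0 < m₀ →
      ‖u - u₀‖ ≤ ‖u - m • (m₀⁻¹ • u₀)‖ + |m - m₀| * (‖u₀‖ / m₀) := by
    intro u u₀ m m₀ hm
    have e : u - u₀ = (u - m • (m₀⁻¹ • u₀)) + (m - m₀) • (m₀⁻¹ • u₀) := by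
      rw [sub_smul, smul_smul m₀, mul_inv_cancel₀ hm.ne', one_smul]; abel
    have e2 : ‖(m - m₀) • (m₀⁻¹ • u₀)‖ = |m - m₀| * (‖u₀‖ / m₀) := by
      rw [norm_smul, norm_smul, Real.norm_eq_abs, Real.norm_of_nonneg (inv_pos.2 hm).le]
      ring
    rw [← e2]
    exact (congrArg norm e).le.trans (norm_add_le _ _)
  have hy := young_terms (ξ := ‖x - r • (r₀⁻¹ • x₀)‖) (η := ‖y - s • (s₀⁻¹ • y₀)‖)
    (α := ‖x₀‖ / r₀) (β := ‖y₀‖ / s₀) (ρ := |r - r₀|) (σ := |s - s₀|) h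
  rw [sq_abs, sq_abs] at hy
  have hm : 2 / Q * (‖x - x₀‖ * ‖y - y₀‖) ≤
      2 / Q * ((‖x - r • (r₀⁻¹ • x₀)‖ + |r - r₀| * (‖x₀‖ / r₀)) *
        (‖y - s • (s₀⁻¹ • y₀)‖ + |s - s₀| * (‖y₀‖ / s₀))) := by
    have hr₀ := h₀.r_pos
    gcongr
    · exact hn x x₀ hr₀
    · exact hn y y₀ h₀.s_pos
  -- The weights match `young_terms`: 4 for the squares of B₁, 124416 cancels the loss in
  -- `B₂_defect` and its mirror image, and 2304 = 2 · 1152 covers the doubled mixed term.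
  simp only [B, dB]
  linarith

/-! ### Continuity of the gradient and passage to the Hessian. -/

lemma continuousAt_optVec {f g : H × H × ℝ × ℝ → H} {ρ σ κ : H × H × ℝ × ℝ → ℝ}
    {V : H × H × ℝ × ℝ} (hf : ContinuousAt f V) (hg : ContinuousAt g V) (hρ : ContinuousAt ρ V)
    (hσ : ContinuousAt σ V) (hκ : ContinuousAt κ V) (hr : 0 < ρ V)
    (hrs : κ V ^ 2 < ρ V * σ V) :
    ContinuousAt (fun V => optVec (f V) (g V) (ρ V) (σ V) (κ V)) V := by
  -- At a zero of f the direction is undefined, so continuity comes from the length bound ‖f‖/ρ.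
  by_cases hx : f V = 0
  · have h0 : optVec (f V) (g V) (ρ V) (σ V) (κ V) = 0 := by rw [hx, optVec, smul_zero]
    have hlim : Tendsto (fun V => ‖f V‖ / ρ V) (𝓝 V) (𝓝 0) := by
      have : ContinuousAt (fun V => ‖f V‖ / ρ V) V := hf.norm.div hρ hr.ne'
      have := this.tendsto
      rwa [hx, norm_zero, zero_div] at this
    rw [ContinuousAt, h0]
    refine squeeze_zero_norm' ?_ hlim
    filter_upwards [hρ.eventually (lt_mem_nhds hr)] with W hW
    rw [norm_optVec _ _ hW]
    exact optLen_le (norm_nonneg _) hW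
  · have hd := sub_pos.2 hrs
    unfold optVec optLen
    refine ContinuousAt.smul (ContinuousAt.div ?_ hf.norm (norm_ne_zero_iff.2 hx)) hf
    refine continuousAt_const.max ((hf.norm.div hρ hr.ne').min (ContinuousAt.div ?_ ?_ hd.ne'))
    · exact (hσ.mul hf.norm).sub (hκ.mul hg.norm)
    · exact (hρ.mul hσ).sub (hκ.pow 2)

/-- The differential of `B₄` as a continuous linear form. -/
def dB₄L (Q : ℝ) (V : H × H × ℝ × ℝ) : (H × H × ℝ × ℝ) →L[ℝ] ℝ :=
  let a := optVec V.1 V.2.1 V.2.2.1 V.2.2.2 (K Q V.2.2.1 V.2.2.2)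
  let b := optVec V.2.1 V.1 V.2.2.2 V.2.2.1 (K Q V.2.2.1 V.2.2.2)
  let t := T Q V.2.2.1 V.2.2.2
  let p₂ := ContinuousLinearMap.snd ℝ H (H × ℝ × ℝ)
  let p₃ := (ContinuousLinearMap.snd ℝ H (ℝ × ℝ)).comp p₂
  let pr := (ContinuousLinearMap.fst ℝ ℝ ℝ).comp p₃
  let ps := (ContinuousLinearMap.snd ℝ ℝ ℝ).comp p₃
  (2 : ℝ) • (innerSL ℝ a).comp (ContinuousLinearMap.fst ℝ H (H × ℝ × ℝ)) +
    (2 : ℝ) • (innerSL ℝ b).comp ((ContinuousLinearMap.fst ℝ H (ℝ × ℝ)).comp p₂) -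
    (‖a‖ ^ 2) • pr - (‖b‖ ^ 2) • ps -
    (2 * ((1 - t / 4) * (t / 2)) * (‖a‖ * ‖b‖)) • (V.2.2.1⁻¹ • pr + V.2.2.2⁻¹ • ps)

lemma dB₄L_apply (Q : ℝ) (V d : H × H × ℝ × ℝ) :
    dB₄L Q V d = dB₄ Q V.1 V.2.1 V.2.2.1 V.2.2.2 d.1 d.2.1 d.2.2.1 d.2.2.2 := by
  simp only [dB₄L, dB₄, dK, dT, _root_.sub_apply, _root_.add_apply,
    FunLike.coe_smul, Pi.smul_apply, ContinuousLinearMap.comp_apply,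
    ContinuousLinearMap.coe_fst', ContinuousLinearMap.coe_snd', innerSL_apply_apply, smul_eq_mul]
  ring

variable {Q : ℝ} {V : H × H × ℝ × ℝ}

lemma continuousAt_dB₄L (hV : V ∈ extDomain H Q) : ContinuousAt (dB₄L (H := H) Q) V := by
  have hK : ContinuousAt (fun V : H × H × ℝ × ℝ => K Q V.2.2.1 V.2.2.2) V :=
    (continuous_K Q).continuousAt
  have hT : ContinuousAt (fun V : H × H × ℝ × ℝ => T Q V.2.2.1 V.2.2.2) V := by
    unfold T; fun_prop
  have ha := continuousAt_optVec (f := fun V : H × H × ℝ × ℝ => V.1) (g := fun V => V.2.1)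
    (ρ := fun V => V.2.2.1) (σ := fun V => V.2.2.2) (by fun_prop) (by fun_prop) (by fun_prop)
    (by fun_prop) hK hV.r_pos hV.K_sq_lt
  have hb := continuousAt_optVec (f := fun V : H × H × ℝ × ℝ => V.2.1) (g := fun V => V.1)
    (ρ := fun V => V.2.2.2) (σ := fun V => V.2.2.1) (by fun_prop) (by fun_prop) (by fun_prop)
    (by fun_prop) hK hV.s_pos (by rw [mul_comm]; exact hV.K_sq_lt)
  have hr : ContinuousAt (fun V : H × H × ℝ × ℝ => V.2.2.1⁻¹) V :=
    ContinuousAt.inv₀ (by fun_prop) hV.r_pos.ne'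
  have hs : ContinuousAt (fun V : H × H × ℝ × ℝ => V.2.2.2⁻¹) V :=
    ContinuousAt.inv₀ (by fun_prop) hV.s_pos.ne'
  have hia : ContinuousAt (fun V : H × H × ℝ × ℝ =>
      innerSL ℝ (optVec V.1 V.2.1 V.2.2.1 V.2.2.2 (K Q V.2.2.1 V.2.2.2))) V :=
    (innerSL ℝ (E := H)).continuous.continuousAt.comp ha
  have hib : ContinuousAt (fun V : H × H × ℝ × ℝ =>
      innerSL ℝ (optVec V.2.1 V.1 V.2.2.2 V.2.2.1 (K Q V.2.2.1 V.2.2.2))) V :=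
    (innerSL ℝ (E := H)).continuous.continuousAt.comp hb
  unfold dB₄L
  dsimp only
  fun_prop

/-- No matching of one-sided derivatives across the cuts is needed: the envelope differential
supports B₄ from below and is continuous. -/
lemma contDiffAt_one_B₄ (hV : V ∈ extDomain H Q) : ContDiffAt ℝ 1 (B₄ (H := H) Q) V := by
  refine contDiffAt_one_of_support (isOpen_extDomain hV.one_le) (L := dB₄L Q)
    (fun W hW => continuousAt_dB₄L hW) (fun W hW W₀ hW₀ => ?_) hV
  have h := B₄_defect W.1 W.2.1 W₀.1 W₀.2.1 hW₀ hW
  have hQ := hV.Q_pos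
  have o1 := optLen_nonneg ‖W₀.1‖ ‖W₀.2.1‖ W₀.2.2.1 W₀.2.2.2 (K Q W₀.2.2.1 W₀.2.2.2)
  have o2 := optLen_nonneg ‖W₀.2.1‖ ‖W₀.1‖ W₀.2.2.2 W₀.2.2.1 (K Q W₀.2.2.1 W₀.2.2.2)
  refine le_trans ?_ h
  rw [dB₄L_apply]
  refine le_add_of_nonneg_right ?_
  positivity

lemma contDiffAt_one_B (c₁ c₂ c₃ c₇ : ℝ) (hV : V ∈ extDomain H Q) :
    ContDiffAt ℝ 1 (B (H := H) c₁ c₂ c₃ c₇ Q) V :=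
  contDiffAt_B c₁ c₂ c₃ c₇ hV (contDiffAt_one_B₄ hV)

/-- The explicit differential is never obtained by differentiating: it is homogeneous and supports a
differentiable function, hence equals its derivative. -/
lemma fderiv_B (hV : V ∈ extDomain H Q) (d : H × H × ℝ × ℝ) :
    fderiv ℝ (B (H := H) 4 124416 124416 2304 Q) V d =
      dB 4 124416 124416 2304 Q V.1 V.2.1 V.2.2.1 V.2.2.2 d.1 d.2.1 d.2.2.1 d.2.2.2 := by
  refine fderiv_eq_of_support (l := fun d => dB 4 124416 124416 2304 Q V.1 V.2.1 V.2.2.1 V.2.2.2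
    d.1 d.2.1 d.2.2.1 d.2.2.2)
    ((contDiffAt_one_B _ _ _ _ hV).differentiableAt one_ne_zero) (fun c v => ?_) ?_ d
  · exact dB_smul _ _ _ _ _ _ _ _ _ _ _ _ _ _
  · filter_upwards [(isOpen_extDomain hV.one_le).mem_nhds hV] with W hW
    have h := B_defect W.1 W.2.1 V.1 V.2.1 hV hW
    have hQ := hV.Q_pos
    have h0 : 0 ≤ 2 / Q * (‖W.1 - V.1‖ * ‖W.2.1 - V.2.1‖) := by positivity
    exact (le_add_of_nonneg_right h0).trans h

/-- One-leg convexity of `B` on the extended domain. -/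
lemma le_B_sub (hV : V ∈ extDomain H Q) {V₀ : H × H × ℝ × ℝ} (hV₀ : V₀ ∈ extDomain H Q) :
    2 / Q * (‖V.1 - V₀.1‖ * ‖V.2.1 - V₀.2.1‖) ≤
      B 4 124416 124416 2304 Q V - B 4 124416 124416 2304 Q V₀ -
        fderiv ℝ (B 4 124416 124416 2304 Q) V₀ (V - V₀) := by
  have h := B_defect V.1 V.2.1 V₀.1 V₀.2.1 hV₀ hV
  rw [fderiv_B hV₀]
  exact le_sub_iff_add_le.2 (le_sub_iff_add_le.2 (by
    refine le_trans (le_of_eq ?_) h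
    simp only [Prod.fst_sub, Prod.snd_sub]
    ring))

lemma le_fderiv_fderiv_B (hV : V ∈ extDomain H Q)
    (h : ContDiffAt ℝ 2 (B (H := H) 4 124416 124416 2304 Q) V) (d : H × H × ℝ × ℝ) :
    2 / Q * (‖d.1‖ * ‖d.2.1‖) ≤
      fderiv ℝ (fderiv ℝ (B (H := H) 4 124416 124416 2304 Q)) V d d := by
  have h1 := le_fderiv_fderiv h ((isOpen_extDomain hV.one_le).mem_nhds hV)
    (q := fun d => 2 / Q * (‖d.1‖ * ‖d.2.1‖)) (fun c v => ?_)
    (fun W hW W₀ hW₀ => le_B_sub hW hW₀) d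
  · have hQ := hV.Q_pos
    have h0 : 0 ≤ 2 / Q * (‖d.1‖ * ‖d.2.1‖) := by positivity
    linarith
  · simp only [Prod.smul_fst, Prod.smul_snd, norm_smul, Real.norm_eq_abs]
    rw [← sq_abs c]; ring

/-! ### The three pieces and their closures. -/

/-- Points on the cuts are limits of points of the regions on either side. -/
lemma mem_closure_leftRegion [Nontrivial H] (hQ : 1 ≤ Q) (hV : V ∈ domain H Q)
    (h : ‖V.2.1‖ * V.2.2.1 = ‖V.1‖ * K Q V.2.2.1 V.2.2.2) :
    V ∈ closure (leftRegion H Q ∩ domain H Q) := by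
  have hA : Admissible Q V.2.2.1 V.2.2.2 := domain_subset_extDomain hQ hV
  -- Lengthening x moves a point of the cut into the left region without touching the weights; if x
  -- = 0, any nonzero direction serves.
  obtain ⟨e, hpos⟩ : ∃ e : H, ∀ t : ℝ, 0 < t → ‖V.1‖ < ‖V.1 + t • e‖ := by
    by_cases hx : V.1 = 0
    · obtain ⟨e, he⟩ := exists_ne (0 : H)
      refine ⟨e, fun t ht => ?_⟩
      rw [hx, norm_zero, zero_add, norm_pos_iff]
      exact smul_ne_zero ht.ne' he
    · refine ⟨V.1, fun t ht => ?_⟩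
      have : V.1 + t • V.1 = (1 + t) • V.1 := by rw [add_smul, one_smul]
      rw [this, norm_smul, Real.norm_of_nonneg (by linarith)]
      nlinarith [norm_pos_iff.2 hx]
  have hlim : Tendsto (fun t : ℝ => ((V.1 + t • e, V.2) : H × H × ℝ × ℝ)) (𝓝[>] 0) (𝓝 V) := by
    have hc : ContinuousAt (fun t : ℝ => ((V.1 + t • e, V.2) : H × H × ℝ × ℝ)) 0 := by fun_prop
    have := hc.tendsto
    rw [zero_smul, add_zero] at this
    exact this.mono_left nhdsWithin_le_nhds
  refine mem_closure_of_tendsto hlim ?_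
  filter_upwards [self_mem_nhdsWithin] with t ht
  refine ⟨?_, hV⟩
  show ‖V.2.1‖ * V.2.2.1 < ‖V.1 + t • e‖ * K Q V.2.2.1 V.2.2.2
  rw [h]
  exact mul_lt_mul_of_pos_right (hpos t ht) hA.K_pos

lemma mem_closure_rightRegion [Nontrivial H] (hQ : 1 ≤ Q) (hV : V ∈ domain H Q)
    (h : ‖V.1‖ * V.2.2.2 = ‖V.2.1‖ * K Q V.2.2.1 V.2.2.2) :
    V ∈ closure (rightRegion H Q ∩ domain H Q) := by
  let φ : H × H × ℝ × ℝ → H × H × ℝ × ℝ := fun V => (V.2.1, V.1, V.2.2.2, V.2.2.1)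
  have hφ : Continuous φ := by fun_prop
  have hmem : ∀ W, W ∈ leftRegion H Q ∩ domain H Q → φ W ∈ rightRegion H Q ∩ domain H Q := by
    rintro W ⟨h1, h2, h3, h4, h5⟩
    refine ⟨?_, h3, h2, by rwa [mul_comm] at h4, by rwa [mul_comm] at h5⟩
    show ‖W.2.1‖ * W.2.2.1 < ‖W.1‖ * K Q W.2.2.2 W.2.2.1
    rw [K_comm]; exact h1
  have hV' : φ V ∈ domain H Q :=
    ⟨hV.2.1, hV.1, by rw [mul_comm]; exact hV.2.2.1, by rw [mul_comm]; exact hV.2.2.2⟩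
  have h1 := mem_closure_leftRegion hQ hV' (by
    show ‖V.1‖ * V.2.2.2 = ‖V.2.1‖ * K Q V.2.2.2 V.2.2.1
    rw [K_comm]; exact h)
  exact map_mem_closure hφ h1 hmem

lemma isPiecewiseC2On_B (c₁ c₂ c₃ c₇ : ℝ) (hQ : 1 ≤ Q) :
    IsPiecewiseC2On (B (H := H) c₁ c₂ c₃ c₇ Q) (domain H Q) := by
  have hsub := domain_subset_extDomain (H := H) hQ
  -- In the zero space all three regions are empty, so a single piece is used; there B₄ vanishes
  -- identically.
  rcases subsingleton_or_nontrivial H with hH | hH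
  · refine ⟨1, fun _ => Set.univ, fun _ => isOpen_univ, ?_, ?_, ?_⟩
    · intro i j hij
      exact absurd (Subsingleton.elim i j) hij
    · intro V hV
      exact Set.mem_iUnion.2 ⟨0, subset_closure ⟨trivial, hV⟩⟩
    · rintro - V ⟨-, hV⟩
      refine contDiffAt_B _ _ _ _ (hsub hV) ?_
      have : (fun _ => 0 : H × H × ℝ × ℝ → ℝ) =ᶠ[𝓝 V] B₄ Q := by
        refine Eventually.of_forall fun W => ?_
        have hx : W.1 = 0 := Subsingleton.elim _ _
        have hy : W.2.1 = 0 := Subsingleton.elim _ _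
        show 0 = H₄ W.1 W.2.1 W.2.2.1 W.2.2.2 _
        simp [H₄, hx, hy]
      exact contDiffAt_const.congr_of_eventuallyEq this.symm
  · refine ⟨3, ![leftRegion H Q, rightRegion H Q, centerRegion H Q], ?_, ?_, ?_, ?_⟩
    · intro i
      fin_cases i
      exacts [isOpen_leftRegion Q, isOpen_rightRegion Q, isOpen_centerRegion Q]
    · have h01 : Disjoint (leftRegion H Q ∩ domain H Q) (rightRegion H Q ∩ domain H Q) :=
        Set.disjoint_left.2 fun V h h' => leftRegion_disjoint_rightRegion (hsub h.2) h.1 h'.1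
      have h02 : Disjoint (leftRegion H Q ∩ domain H Q) (centerRegion H Q ∩ domain H Q) :=
        Set.disjoint_left.2 fun V h h' => lt_asymm h.1 h'.1.1
      have h12 : Disjoint (rightRegion H Q ∩ domain H Q) (centerRegion H Q ∩ domain H Q) :=
        Set.disjoint_left.2 fun V h h' => lt_asymm h.1 h'.1.2
      intro i j hij
      fin_cases i <;> fin_cases j
      exacts [absurd rfl hij, h01, h02, h01.symm, absurd rfl hij, h12, h02.symm, h12.symm,
        absurd rfl hij]
    · intro V hV
      rw [Set.mem_iUnion]
      rcases lt_trichotomy (‖V.2.1‖ * V.2.2.1) (‖V.1‖ * K Q V.2.2.1 V.2.2.2) with h | h | h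
      · exact ⟨0, subset_closure ⟨h, hV⟩⟩
      · exact ⟨0, mem_closure_leftRegion hQ hV h⟩
      rcases lt_trichotomy (‖V.1‖ * V.2.2.2) (‖V.2.1‖ * K Q V.2.2.1 V.2.2.2) with h' | h' | h'
      · exact ⟨1, subset_closure ⟨h', hV⟩⟩
      · exact ⟨1, mem_closure_rightRegion hQ hV h'⟩
      · exact ⟨2, subset_closure ⟨⟨h, h'⟩, hV⟩⟩
    · intro i
      fin_cases i
      · exact fun V hV => contDiffAt_B _ _ _ _ (hsub hV.2) (contDiffAt_B₄_left (hsub hV.2) hV.1)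
      · exact fun V hV => contDiffAt_B _ _ _ _ (hsub hV.2) (contDiffAt_B₄_right (hsub hV.2) hV.1)
      · exact fun V hV => contDiffAt_B _ _ _ _ (hsub hV.2) (contDiffAt_B₄_center (hsub hV.2) hV.1)

/-! ### Second partial derivatives in the vector variables. -/

/-- Lipschitz bound for the gradient of `B` in one of its two vector variables. -/
lemma gradient_lipschitz {r s k ε A A₀ c : ℝ} (hε : 0 < ε) (hr : ε ≤ r) (hs : 0 < s)
    (hrs : 1 ≤ r * s) (hk : k ^ 2 ≤ 4 / 5) (hA : 0 ≤ A) (hA₀ : A ≤ A₀ * ε⁻¹) (hc : 0 ≤ c)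
    (x x' y d : H) :
    |2 * inner ℝ (A • x' + c • optVec x' y r s k) d -
      2 * inner ℝ (A • x + c • optVec x y r s k) d| ≤
      2 * (A₀ + 15 * c) * ε⁻¹ * ‖x' - x‖ * ‖d‖ := by
  have hr0 : 0 < r := hε.trans_le hr
  have hlt : k ^ 2 < r * s := by linarith
  -- Since k² ≤ 4/5 ≤ 4rs/5, the discriminant is at least rs/5.
  have hl : s / (r * s - k ^ 2) ≤ 5 * ε⁻¹ := by
    rw [← div_eq_mul_inv, div_le_div_iff₀ (sub_pos.2 hlt) hε]
    nlinarith
  have h1 := optVec_lipschitz x' x y hr0 hs hlt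
  have h2 : ‖optVec x' y r s k - optVec x y r s k‖ ≤ 3 * (5 * ε⁻¹) * ‖x' - x‖ :=
    h1.trans (by gcongr)
  have e : A • x' + c • optVec x' y r s k - (A • x + c • optVec x y r s k) =
      A • (x' - x) + c • (optVec x' y r s k - optVec x y r s k) := by module
  rw [← mul_sub, ← inner_sub_left, e, abs_mul, abs_two]
  have h3 := abs_real_inner_le_norm (A • (x' - x) + c • (optVec x' y r s k - optVec x y r s k)) d
  have h4 : ‖A • (x' - x) + c • (optVec x' y r s k - optVec x y r s k)‖ ≤
      A₀ * ε⁻¹ * ‖x' - x‖ + c * (3 * (5 * ε⁻¹) * ‖x' - x‖) := by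
    refine (norm_add_le _ _).trans ?_
    rw [norm_smul, norm_smul, Real.norm_of_nonneg hA, Real.norm_of_nonneg hc]
    gcongr
  have h5 := mul_le_mul_of_nonneg_right h4 (norm_nonneg d)
  linarith

lemma dQuad_zero (x dx : H) (m : ℝ) : dQuad x m dx 0 = 2 * (m⁻¹ * inner ℝ x dx) := by
  rw [dQuad, real_inner_smul_left]; ring

lemma dB_left (c₁ c₂ c₃ c₇ Q : ℝ) (x y : H) (r s : ℝ) (d : H) :
    dB c₁ c₂ c₃ c₇ Q x y r s d 0 0 0 =
      2 * inner ℝ ((c₁ * r⁻¹ + c₂ * (M r s (N Q r s + 1))⁻¹ + c₃ * r⁻¹ +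
        c₇ * ((M r s (K Q r s + 1))⁻¹ + r⁻¹)) • x + c₇ • optVec x y r s (K Q r s)) d := by
  have hK : dK Q r s 0 0 = 0 := by simp [dK, dT]
  have hN : dN Q r s 0 0 = 0 := by simp [dN, dT]
  have hM : ∀ s z, dM s z 0 0 0 = 0 := by intro s z; simp [dM]
  simp only [dB, dB₇, dB₁, dB₄, dBM, hK, hN, hM, dQuad_zero, inner_add_left, real_inner_smul_left,
    inner_zero_right]
  ring

lemma dB_right (c₁ c₂ c₃ c₇ Q : ℝ) (x y : H) (r s : ℝ) (d : H) :
    dB c₁ c₂ c₃ c₇ Q x y r s 0 d 0 0 =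
      2 * inner ℝ ((c₁ * s⁻¹ + c₃ * (M s r (N Q r s + 1))⁻¹ + c₂ * s⁻¹ +
        c₇ * ((M s r (K Q r s + 1))⁻¹ + s⁻¹)) • y + c₇ • optVec y x s r (K Q r s)) d := by
  have hK : dK Q r s 0 0 = 0 := by simp [dK, dT]
  have hN : dN Q r s 0 0 = 0 := by simp [dN, dT]
  have hM : ∀ s z, dM s z 0 0 0 = 0 := by intro s z; simp [dM]
  simp only [dB, dB₇, dB₁, dB₄, dBM, hK, hN, hM, dQuad_zero, inner_add_left, real_inner_smul_left,
    inner_zero_right]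
  ring

lemma coeff_bounds {c₁ c₂ c₃ c₇ r s z w ε : ℝ} (h₁ : 0 ≤ c₁) (h₂ : 0 ≤ c₂) (h₃ : 0 ≤ c₃)
    (h₇ : 0 ≤ c₇) (hε : 0 < ε) (hr : ε ≤ r) (hs : 0 < s) (hrs : 1 ≤ r * s) (hz : 1 ≤ z)
    (hw : 1 ≤ w) :
    0 ≤ c₁ * r⁻¹ + c₂ * (M r s z)⁻¹ + c₃ * r⁻¹ + c₇ * ((M r s w)⁻¹ + r⁻¹) ∧
    c₁ * r⁻¹ + c₂ * (M r s z)⁻¹ + c₃ * r⁻¹ + c₇ * ((M r s w)⁻¹ + r⁻¹) ≤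
      (c₁ + c₂ + c₃ + 2 * c₇) * ε⁻¹ := by
  have hr0 : 0 < r := hε.trans_le hr
  have hMz := hr.trans (le_M hs hrs hz)
  have hMw := hr.trans (le_M hs hrs hw)
  have hz0 := hε.trans_le hMz
  have hw0 := hε.trans_le hMw
  refine ⟨by positivity, ?_⟩
  calc _ ≤ c₁ * ε⁻¹ + c₂ * ε⁻¹ + c₃ * ε⁻¹ + c₇ * (ε⁻¹ + ε⁻¹) := by gcongr
    _ = _ := by ring

/-- On rs ≤ Q one has T ≤ 1, so K ≤ 7/8. This keeps rs - K² uniformly away from 0, independently of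
Q. -/
lemma K_sq_le {r s : ℝ} (h : Admissible Q r s) (hle : r * s ≤ Q) : K Q r s ^ 2 ≤ 4 / 5 := by
  have h1 : T Q r s ^ 2 ≤ 1 := by rw [h.T_sq, div_le_one h.Q_pos]; exact hle
  have h2 : T Q r s ≤ 1 := by nlinarith [h.T_pos]
  have h3 : K Q r s ≤ 7 / 8 := by rw [K_eq]; nlinarith
  nlinarith [h.K_pos]

lemma abs_fderiv_fderiv_left_le (hQ : 1 ≤ Q) {ε : ℝ} (hε : 0 < ε) {x y : H} {r s : ℝ}
    (hV : (x, y, r, s) ∈ truncDomain H Q ε)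
    (h : ContDiffAt ℝ 2 (fun x' => B 4 124416 124416 2304 Q (x', y, r, s)) x) (d : H) :
    |fderiv ℝ (fderiv ℝ (fun x' => B 4 124416 124416 2304 Q (x', y, r, s))) x d d| ≤
      576008 * ε⁻¹ * ‖d‖ ^ 2 := by
  obtain ⟨hD, hr, -, -, -⟩ := hV
  have hA : Admissible Q r s := domain_subset_extDomain hQ hD
  have hf : ∀ x' d : H, fderiv ℝ (fun x' => B 4 124416 124416 2304 Q (x', y, r, s)) x' d =
      dB 4 124416 124416 2304 Q x' y r s d 0 0 0 := by
    intro x' d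
    have hx' : ((x', y, r, s) : H × H × ℝ × ℝ) ∈ extDomain H Q := hA
    have h1 := ((contDiffAt_one_B 4 124416 124416 2304 hx').differentiableAt
      one_ne_zero).hasFDerivAt.comp x' (hasFDerivAt_prodMk_left (𝕜 := ℝ) x' (y, r, s))
    have h2 := h1.fderiv
    rw [Function.comp_def] at h2
    rw [h2]
    exact fderiv_B hx' (d, 0, 0, 0)
  refine abs_fderiv_fderiv_le h (by positivity) (fun x' d => ?_) d
  rw [hf, hf, dB_left, dB_left]
  obtain ⟨h0, hle⟩ := coeff_bounds (c₁ := 4) (c₂ := 124416) (c₃ := 124416) (c₇ := 2304)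
    (z := N Q r s + 1) (w := K Q r s + 1)
    (by norm_num) (by norm_num) (by norm_num) (by norm_num) hε hr hA.s_pos hD.2.2.1
    (by linarith [hA.N_pos]) (by linarith [hA.K_pos])
  refine (gradient_lipschitz hε hr hA.s_pos hD.2.2.1 (K_sq_le hA hD.2.2.2) h0 hle (by norm_num)
    x x' y d).trans (le_of_eq ?_)
  norm_num

lemma abs_fderiv_fderiv_right_le (hQ : 1 ≤ Q) {ε : ℝ} (hε : 0 < ε) {x y : H} {r s : ℝ}
    (hV : (x, y, r, s) ∈ truncDomain H Q ε)
    (h : ContDiffAt ℝ 2 (fun y' => B 4 124416 124416 2304 Q (x, y', r, s)) y) (d : H) :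
    |fderiv ℝ (fderiv ℝ (fun y' => B 4 124416 124416 2304 Q (x, y', r, s))) y d d| ≤
      576008 * ε⁻¹ * ‖d‖ ^ 2 := by
  obtain ⟨hD, -, -, hs, -⟩ := hV
  have hA : Admissible Q r s := domain_subset_extDomain hQ hD
  have hsr : 1 ≤ s * r := by rw [mul_comm]; exact hD.2.2.1
  have hf : ∀ y' d : H, fderiv ℝ (fun y' => B 4 124416 124416 2304 Q (x, y', r, s)) y' d =
      dB 4 124416 124416 2304 Q x y' r s 0 d 0 0 := by
    intro y' d
    have hy' : ((x, y', r, s) : H × H × ℝ × ℝ) ∈ extDomain H Q := hA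
    have h1 := ((contDiffAt_one_B 4 124416 124416 2304 hy').differentiableAt
      one_ne_zero).hasFDerivAt.comp y' ((hasFDerivAt_prodMk_right (𝕜 := ℝ) x (y', r, s)).comp y'
        (hasFDerivAt_prodMk_left (𝕜 := ℝ) y' (r, s)))
    have h2 := h1.fderiv
    rw [Function.comp_def, Function.comp_def] at h2
    rw [h2]
    exact fderiv_B hy' (0, d, 0, 0)
  refine abs_fderiv_fderiv_le h (by positivity) (fun y' d => ?_) d
  rw [hf, hf, dB_right, dB_right]
  obtain ⟨h0, hle⟩ := coeff_bounds (c₁ := 4) (c₂ := 124416) (c₃ := 124416) (c₇ := 2304)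
    (z := N Q r s + 1) (w := K Q r s + 1)
    (by norm_num) (by norm_num) (by norm_num) (by norm_num) hε hs hA.r_pos hsr
    (by linarith [hA.N_pos]) (by linarith [hA.K_pos])
  refine (gradient_lipschitz hε hs hA.r_pos hsr (K_sq_le hA hD.2.2.2) h0 hle (by norm_num)
    y y' x d).trans (le_of_eq ?_)
  norm_num

end Main

end Bellman

end

theorem lemma3 :
    ∃ c₁ c₂ c₃ c₇ C : ℝ, 0 < c₁ ∧ 0 < c₂ ∧ 0 < c₃ ∧ 0 < c₇ ∧ 0 < C ∧
      ∀ (H : Type*) [NormedAddCommGroup H] [InnerProductSpace ℝ H] [CompleteSpace H]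
        (Q : ℝ), 1 ≤ Q →
        ∀ B : H × H × ℝ × ℝ → ℝ, B = Bellman.B c₁ c₂ c₃ c₇ Q →
        -- `B` is `C¹`
        (∀ V ∈ Bellman.domain H Q, ContDiffAt ℝ 1 B V) ∧
        -- `B` is piecewise `C²`, the only possible exceptions being the cuts
        Bellman.IsPiecewiseC2On B (Bellman.domain H Q) ∧
        (∀ (x y : H) (r s : ℝ), (x, y, r, s) ∈ Bellman.domain H Q →
          ‖y‖ * r ≠ ‖x‖ * Bellman.K Q r s → ‖x‖ * s ≠ ‖y‖ * Bellman.K Q r s →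
          ContDiffAt ℝ 2 B (x, y, r, s)) ∧
        -- size
        (∀ (x y : H) (r s : ℝ), (x, y, r, s) ∈ Bellman.domain H Q →
          0 ≤ B (x, y, r, s) ∧ B (x, y, r, s) ≤ C * (‖x‖ ^ 2 / r + ‖y‖ ^ 2 / s)) ∧
        -- convexity wherever `B` is `C²`
        (∀ V ∈ Bellman.domain H Q, ContDiffAt ℝ 2 B V →
          ∀ (dx dy : H) (dr ds : ℝ),
            2 / Q * (‖dx‖ * ‖dy‖) ≤
              fderiv ℝ (fderiv ℝ B) V (dx, dy, dr, ds) (dx, dy, dr, ds)) ∧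
        -- discrete one-leg convexity
        (∀ V ∈ Bellman.domain H Q, ∀ V₀ ∈ Bellman.domain H Q,
          2 / Q * (‖V.1 - V₀.1‖ * ‖V.2.1 - V₀.2.1‖) ≤
            B V - B V₀ - fderiv ℝ B V₀ (V - V₀)) ∧
        -- bounds on the second partial derivatives in `x` and in `y`, wherever they make sense
        (∀ ε : ℝ, 0 < ε → ε < 1 → ∀ (x y : H) (r s : ℝ),
          (x, y, r, s) ∈ Bellman.truncDomain H Q ε →
          (ContDiffAt ℝ 2 (fun x' => B (x', y, r, s)) x → ∀ dx : H,
            |fderiv ℝ (fderiv ℝ (fun x' => B (x', y, r, s))) x dx dx| ≤ C * ε⁻¹ * ‖dx‖ ^ 2) ∧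
          (ContDiffAt ℝ 2 (fun y' => B (x, y', r, s)) y → ∀ dy : H,
            |fderiv ℝ (fderiv ℝ (fun y' => B (x, y', r, s))) y dy dy| ≤ C * ε⁻¹ * ‖dy‖ ^ 2)) := by
  -- 576008 = 2(c₁ + c₂ + c₃ + 2c₇ + 15c₇), from `coeff_bounds` and `gradient_lipschitz`; it also
  -- exceeds the size constant c₁ + c₂ + c₃ + 3c₇.
  refine ⟨4, 124416, 124416, 2304, 576008, by norm_num, by norm_num, by norm_num, by norm_num,
    by norm_num, ?_⟩
  intro H _ _ _ Q hQ B hB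
  subst hB
  have hsub := Bellman.domain_subset_extDomain (H := H) hQ
  refine ⟨fun V hV => Bellman.contDiffAt_one_B _ _ _ _ (hsub hV),
    Bellman.isPiecewiseC2On_B _ _ _ _ hQ, fun x y r s hV h h' =>
      Bellman.contDiffAt_B _ _ _ _ (hsub hV) (Bellman.contDiffAt_B₄_of_ne (hsub hV) h h'),
    fun x y r s hV => ?_, fun V hV h dx dy dr ds =>
      Bellman.le_fderiv_fderiv_B (hsub hV) h (dx, dy, dr, ds),
    fun V hV V₀ hV₀ => Bellman.le_B_sub (hsub hV) (hsub hV₀), fun ε hε _ x y r s hV =>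
      ⟨fun h dx => Bellman.abs_fderiv_fderiv_left_le hQ hε hV h dx,
        fun h dy => Bellman.abs_fderiv_fderiv_right_le hQ hε hV h dy⟩⟩
  have hr : 0 < r := hV.1
  have hs : 0 < s := hV.2.1
  obtain ⟨h0, hle⟩ := Bellman.B_bounds (c₁ := 4) (c₂ := 124416) (c₃ := 124416) (c₇ := 2304)
    (by norm_num) (by norm_num) (by norm_num) (by norm_num) hQ x y hV
  refine ⟨h0, hle.trans ?_⟩
  gcongr
  norm_num
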